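/- Let $F$ be a field of arbitrary characteristic and let $\pi$ be a $3$-fold quadratic Pfister form over $F$, that is, a quadratic form isometric to $(b_1\otimes b_2)\otimes\varphi$, where $b_1,b_2$ are binary symmetric bilinear forms representing $1$ with $b_1\otimes b_2$ nondegenerate, and $\varphi$ is a nonsingular binary quadratic form representing $1$. For a nonsingular quadratic form $q$ on a finite-dimensional space $V$, with polar form $b_q$, let $\mathrm{Ad}_q=(\mathrm{End}_F(V),\sigma_q,f_q)$, where $\sigma_q$ is the involution adjoint to $b_q$ and $f_q$ is the semi-trace on $\mathrm{Sym}(\mathrm{End}_F(V),\sigma_q)$ such that $f_q\bigl(z\mapsto x\,b_q(x,z)\bigr)=q(x)$ for all $x\in V$. For an $F$-central simple algebra with quadratic pair $(A,\sigma,f)$, let $\mathcal C(A,\sigma,f)$ be its Clifford algebra, the quotient of the tensor algebra $T(A)$ by the relations $s=f(s)$ for $s\in\mathrm{Sym}(A,\sigma)$ and $u=\mathrm{Sand}(u)(\ell)$ for $u\in A\otimes A$ with $\sigma_2(u)=u$; here $\mathrm{Sand}(a\otimes b)(x)=axb$, the map $\sigma_2$ is defined by $\mathrm{Sand}(\sigma_2(u))(x)=\mathrm{Sand}(u)(\sigma(x))$,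 and $\ell\in A$ satisfies $\ell+\sigma(\ell)=1$ and $f(s)=\mathrm{Trd}_A(\ell s)$ for all $s\in\mathrm{Sym}(A,\sigma)$. Let $c:A\to\mathcal C(A,\sigma,f)$ be the canonical map and let $\underline\sigma$ be the canonical involution, given by $\underline\sigma(c(a))=c(\sigma(a))$ for $a\in A$. Then, for $(A,\sigma,f)=\mathrm{Ad}_\pi$ and $\mathcal C=\mathcal C(\mathrm{Ad}_\pi)$ with centre $Z$, the map $\underline{f_\pi}:\mathrm{Sym}(\mathcal C,\underline{\sigma_\pi})\to Z$, $s\mapsto \mathrm{Trd}_{\mathcal C}(c(\lambda)s)$, where $\lambda\in\mathrm{End}_F(V)$ is any element of trace $1$, does not depend on $\lambda$; the pair $(\underline{\sigma_\pi},\underline{f_\pi})$ is a quadratic pair on $\mathcal C$ (the canonical one); and there is an isomorphism of $F$-algebras with quadratic pair $$(\mathcal C(\mathrm{Ad}_\pi),\underline{\sigma_\pi},\underline{f_\pi})\;\simeq\;\mathrm{Ad}_\pi\times\mathrm{Ad}_\pi .$$ -/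

import Mathlib

open scoped TensorProduct

noncomputable section

/-! ### Reduced traces -/

section ReducedTrace

/-- A representation `ρ : A → M_n(Ω)` over an algebraic closure `Ω` of `F` is absolutely
irreducible if `n > 0` and the image of `A` spans `M_n(Ω)` over `Ω`. When `A` is central simple
over `F`, this says that the induced map `A ⊗ Ω → M_n(Ω)` is an isomorphism. -/
def IsAbsolutelyIrreducible {F A : Type*} [Field F] [Ring A] [Algebra F A] {n : ℕ}
    (ρ : A →ₐ[F] Matrix (Fin n) (Fin n) (AlgebraicClosure F)) : Prop :=
  0 < n ∧ Submodule.span (AlgebraicClosure F) (Set.range ρ) = ⊤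

/-- `t : A → Z(A)` is the reduced trace of `A` over its centre: in every absolutely irreducible
representation `ρ` over an algebraic closure, the central element `t a` acts by the trace of the
matrix `ρ a`. -/
def IsReducedTrace (F A : Type*) [Field F] [Ring A] [Algebra F A]
    (t : A →ₗ[F] Subalgebra.center F A) : Prop :=
  ∀ (n : ℕ) (ρ : A →ₐ[F] Matrix (Fin n) (Fin n) (AlgebraicClosure F)),
    IsAbsolutelyIrreducible ρ →
      ∀ a : A, ρ (t a : A) = Matrix.scalar (Fin n) (Matrix.trace (ρ a))

/-- `A` has a reduced trace over its centre, and its absolutely irreducible representations are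
jointly faithful, so that the reduced trace is unique. Among finite-dimensional algebras this
singles out the semisimple ones; it holds in particular for central simple algebras and for
finite products of such. -/
structure HasReducedTrace (F A : Type*) [Field F] [Ring A] [Algebra F A] : Prop where
  exists_trace : ∃ t, IsReducedTrace F A t
  faithful : ∀ a : A,
    (∀ (n : ℕ) (ρ : A →ₐ[F] Matrix (Fin n) (Fin n) (AlgebraicClosure F)),
      IsAbsolutelyIrreducible ρ → ρ a = 0) → a = 0

open Classical in
/-- The reduced trace of `A`, with values in the centre of `A`. -/
def reducedTrace (F A : Type*) [Field F] [Ring A] [Algebra F A] :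
    A →ₗ[F] Subalgebra.center F A :=
  if h : ∃ t, IsReducedTrace F A t then h.choose else 0

theorem HasReducedTrace.reducedTrace_eq {F A : Type*} [Field F] [Ring A] [Algebra F A]
    (h : HasReducedTrace F A) {t : A →ₗ[F] Subalgebra.center F A} (ht : IsReducedTrace F A t) :
    reducedTrace F A = t := by
  have h0 : IsReducedTrace F A (reducedTrace F A) := by
    unfold reducedTrace
    rw [dif_pos h.exists_trace]
    exact h.exists_trace.choose_spec
  ext a
  rw [← sub_eq_zero]
  refine h.faithful _ fun n ρ hρ => ?_
  rw [map_sub, h0 n ρ hρ, ht n ρ hρ, sub_self]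

theorem trace_map_of_span_eq_top {F K ι : Type*} [Field F] [Field K] [Algebra F K] [Fintype ι]
    [DecidableEq ι] {n : ℕ} (hn : 0 < n) (ρ : Matrix ι ι F →ₐ[F] Matrix (Fin n) (Fin n) K)
    (hρ : Submodule.span K (Set.range ρ) = ⊤) (M : Matrix ι ι F) :
    (ρ M).trace = algebraMap F K M.trace := by
  have : Nonempty (Fin n) := ⟨⟨0, hn⟩⟩
  -- the image of a diagonal matrix unit has trace one
  have key : ∀ i : ι, (ρ (Matrix.single i i 1)).trace = 1 := by
    intro i
    set e := ρ (Matrix.single i i 1) with he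
    have hee : e * e = e := by rw [he, ← map_mul]; simp
    have hXe : ∀ X : Matrix (Fin n) (Fin n) K, ∃ c : K, e * X * e = c • e := by
      intro X
      have hX : X ∈ Submodule.span K (Set.range ρ) := hρ ▸ Submodule.mem_top
      induction hX using Submodule.span_induction with
      | mem x hx =>
        obtain ⟨N, rfl⟩ := hx
        refine ⟨algebraMap F K (N i i), ?_⟩
        rw [he, ← map_mul, ← map_mul, Matrix.single_mul_mul_single]
        rw [algebraMap_smul, ← map_smul, Matrix.smul_single]
        simp
      | zero => exact ⟨0, by simp⟩
      | add x y _ _ hx hy =>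
        obtain ⟨c, hc⟩ := hx
        obtain ⟨d, hd⟩ := hy
        exact ⟨c + d, by rw [mul_add, add_mul, hc, hd, add_smul]⟩
      | smul k x _ hx =>
        obtain ⟨c, hc⟩ := hx
        exact ⟨k * c, by rw [Matrix.mul_smul, Matrix.smul_mul, hc, smul_smul]⟩
    have he0 : e ≠ 0 := by
      intro h0
      have hall : ∀ j, ρ (Matrix.single j j 1) = 0 := by
        intro j
        have : (Matrix.single j j 1 : Matrix ι ι F)
            = Matrix.single j i 1 * Matrix.single i i 1 * Matrix.single i j 1 := by simp
        rw [this, map_mul, map_mul, ← he, h0]; simp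
      have h1 : ρ 1 = 0 := by
        have hone : (1 : Matrix ι ι F) = ∑ j, Matrix.single j j 1 := by
          rw [Matrix.sum_single_one]
        rw [hone, map_sum]
        exact Finset.sum_eq_zero fun j _ => hall j
      rw [map_one] at h1
      exact one_ne_zero h1
    obtain ⟨a, b, hab⟩ : ∃ a b, e a b ≠ 0 := by
      by_contra! h
      exact he0 (Matrix.ext h)
    obtain ⟨c, hc⟩ := hXe (Matrix.single b a 1)
    have hent : ∀ p q, e p b * e a q = c * e p q := by
      intro p q
      have := congrFun (congrFun hc p) q
      rw [Matrix.smul_apply, smul_eq_mul] at this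
      rw [← this]
      simp [Matrix.mul_apply, Matrix.single_apply, Finset.sum_ite_eq, ite_and]
    have hcab : c = e a b := by
      have := hent a b
      exact (mul_right_cancel₀ hab this).symm
    have htr : e a b * e.trace = e a b := by
      calc e a b * e.trace = ∑ p, e a p * e p b := by
            rw [Matrix.trace, Finset.mul_sum]
            refine Finset.sum_congr rfl fun p _ => ?_
            rw [Matrix.diag_apply, ← hcab, ← hent p p, mul_comm]
        _ = (e * e) a b := by rw [Matrix.mul_apply]
        _ = e a b := by rw [hee]
    exact mul_left_cancel₀ hab (by rw [htr, mul_one])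
  have hoff : ∀ i j : ι, i ≠ j → (ρ (Matrix.single i j 1)).trace = 0 := by
    intro i j hij
    have h1 : (Matrix.single i j 1 : Matrix ι ι F)
        = Matrix.single i j 1 * Matrix.single j j 1 := by simp
    rw [h1, map_mul, Matrix.trace_mul_comm, ← map_mul,
      Matrix.single_mul_single_of_ne _ _ _ _ hij.symm, map_zero, Matrix.trace_zero]
  have hs : ∀ i j (c : F), Matrix.single i j c = c • (Matrix.single i j 1 : Matrix ι ι F) := by
    intro i j c; rw [Matrix.smul_single]; simp
  induction M using Matrix.induction_on' with
  | h_zero => simp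
  | h_add p q hp hq => rw [map_add, Matrix.trace_add, hp, hq, Matrix.trace_add, map_add]
  | h_std_basis i j c =>
    rw [hs, map_smul, Matrix.trace_smul, Matrix.trace_smul, Algebra.smul_def, smul_eq_mul, map_mul]
    by_cases hij : i = j
    · subst hij; rw [key]; simp
    · rw [hoff i j hij]; simp [Matrix.trace_single_eq_of_ne _ _ _ hij]

/-- The trace of an endomorphism, seen in the centre of `End_F(V)`. -/
def endTrace (F V : Type*) [Field F] [AddCommGroup V] [Module F V] :
    Module.End F V →ₗ[F] Subalgebra.center F (Module.End F V) :=
  (Algebra.linearMap F (Subalgebra.center F (Module.End F V))).comp (LinearMap.trace F V)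

theorem endTrace_coe {F V : Type*} [Field F] [AddCommGroup V] [Module F V] (a : Module.End F V) :
    (endTrace F V a : Module.End F V) = algebraMap F _ (LinearMap.trace F V a) := rfl

theorem isReducedTrace_end (F V : Type*) [Field F] [AddCommGroup V] [Module F V]
    [FiniteDimensional F V] : IsReducedTrace F (Module.End F V) (endTrace F V) := by
  intro n ρ hρ a
  have b := Module.finBasis F V
  let E := LinearMap.toMatrixAlgEquiv b
  have h := trace_map_of_span_eq_top hρ.1 (ρ.comp E.symm.toAlgHom)
    (by
      rw [← hρ.2]
      congr 1
      ext x
      constructor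
      · rintro ⟨y, rfl⟩; exact ⟨E.symm y, rfl⟩
      · rintro ⟨y, rfl⟩; exact ⟨E y, by simp⟩) (E a)
  have h2 : (E a).trace = LinearMap.trace F V a :=
    (LinearMap.trace_eq_matrix_trace F b a).symm
  rw [h2] at h
  have h3 : (ρ.comp E.symm.toAlgHom) (E a) = ρ a := by simp
  rw [h3] at h
  rw [endTrace_coe, h, AlgHom.commutes]
  rfl

theorem hasReducedTrace_end (F V : Type*) [Field F] [AddCommGroup V] [Module F V]
    [FiniteDimensional F V] : HasReducedTrace F (Module.End F V) := by
  refine ⟨⟨_, isReducedTrace_end F V⟩, fun z hz => ?_⟩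
  rcases subsingleton_or_nontrivial V with hV | hV
  · exact Subsingleton.elim _ _
  have b := Module.finBasis F V
  let E := LinearMap.toMatrixAlgEquiv b
  let ρ : Module.End F V →ₐ[F] Matrix (Fin (Module.finrank F V)) (Fin (Module.finrank F V))
      (AlgebraicClosure F) :=
    (AlgHom.mapMatrix (Algebra.ofId F (AlgebraicClosure F))).comp E.toAlgHom
  have hρ : IsAbsolutelyIrreducible ρ := by
    refine ⟨Module.finrank_pos, ?_⟩
    rw [eq_top_iff]
    intro M _
    have hs : ∀ i j (c : AlgebraicClosure F), Matrix.single i j c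
        = c • (Matrix.single i j 1 : Matrix (Fin (Module.finrank F V))
          (Fin (Module.finrank F V)) (AlgebraicClosure F)) := by
      intro i j c; rw [Matrix.smul_single]; simp
    induction M using Matrix.induction_on' with
    | h_zero => exact zero_mem _
    | h_add p q hp hq => exact add_mem (hp trivial) (hq trivial)
    | h_std_basis i j c =>
      rw [hs]
      refine Submodule.smul_mem _ _ (Submodule.subset_span ⟨E.symm (Matrix.single i j 1), ?_⟩)
      simp [ρ, Algebra.ofId_apply]
  have h := hz _ ρ hρ
  have hinj : Function.Injective ρ := by
    intro x y hxy
    apply E.injective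
    ext i j
    have := congrFun (congrFun hxy i) j
    exact (algebraMap F (AlgebraicClosure F)).injective this
  exact hinj (by rw [h, map_zero])

theorem coe_reducedTrace_end {F V : Type*} [Field F] [AddCommGroup V] [Module F V]
    [FiniteDimensional F V] (a : Module.End F V) :
    (reducedTrace F (Module.End F V) a : Module.End F V)
      = algebraMap F _ (LinearMap.trace F V a) := by
  rw [(hasReducedTrace_end F V).reducedTrace_eq (isReducedTrace_end F V), endTrace_coe]

/-- An absolutely irreducible representation of a product factors through one of the factors. -/
theorem IsAbsolutelyIrreducible.factor {F A B : Type*} [Field F] [Ring A] [Algebra F A] [Ring B]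
    [Algebra F B] {n : ℕ} {ρ : A × B →ₐ[F] Matrix (Fin n) (Fin n) (AlgebraicClosure F)}
    (hρ : IsAbsolutelyIrreducible ρ) :
    (∃ ρ₁ : A →ₐ[F] Matrix (Fin n) (Fin n) (AlgebraicClosure F),
      IsAbsolutelyIrreducible ρ₁ ∧ ∀ x, ρ x = ρ₁ x.1) ∨
    (∃ ρ₂ : B →ₐ[F] Matrix (Fin n) (Fin n) (AlgebraicClosure F),
      IsAbsolutelyIrreducible ρ₂ ∧ ∀ x, ρ x = ρ₂ x.2) := by
  have : Nonempty (Fin n) := ⟨⟨0, hρ.1⟩⟩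
  have hcomm : ∀ X, Commute (ρ (1, 0)) X := by
    intro X
    have hX : X ∈ Submodule.span (AlgebraicClosure F) (Set.range ρ) := hρ.2 ▸ Submodule.mem_top
    induction hX using Submodule.span_induction with
    | mem x hx =>
      obtain ⟨y, rfl⟩ := hx
      change ρ _ * ρ _ = ρ _ * ρ _
      rw [← map_mul, ← map_mul]
      congr 1
      ext <;> simp
    | zero => exact Commute.zero_right _
    | add x y _ _ hx hy => exact hx.add_right hy
    | smul k x _ hx => exact hx.smul_right k
  obtain ⟨c, hc⟩ := Matrix.mem_range_scalar_of_commute_single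
    (M := ρ (1, 0)) (fun i j _ => (hcomm _).symm)
  have hsum : ρ (1, 0) + ρ (0, 1) = 1 := by
    rw [← map_add, ← map_one ρ]; congr 1; ext <;> simp
  have hcc : c * c = c := by
    have h1 : ρ (1, 0) * ρ (1, 0) = ρ (1, 0) := by rw [← map_mul]; simp
    rw [← hc, ← map_mul] at h1
    exact Matrix.scalar_inj.mp h1
  have hc01 : c = 0 ∨ c = 1 := by
    rcases eq_or_ne c 0 with h | h
    · exact Or.inl h
    · exact Or.inr (mul_left_cancel₀ h (by rw [hcc, mul_one]))
  have hdec : ∀ x : A × B, ρ x = ρ (x.1, 0) + ρ (0, x.2) := by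
    intro x; rw [← map_add]; simp
  rcases hc01 with h | h
  · right
    have h10 : ρ (1, 0) = 0 := by rw [← hc, h, map_zero]
    have hz : ∀ a : A, ρ (a, 0) = 0 := by
      intro a
      have : ((a, 0) : A × B) = (a, 0) * (1, 0) := by simp
      rw [this, map_mul, h10, mul_zero]
    have hx : ∀ x, ρ x = ρ (0, x.2) := fun x => by rw [hdec x, hz, zero_add]
    let ρ₂ : B →ₐ[F] Matrix (Fin n) (Fin n) (AlgebraicClosure F) :=
      AlgHom.ofLinearMap (ρ.toLinearMap.comp (LinearMap.inr F A B))
        (by change ρ (0, 1) = 1; rw [← hsum, h10, zero_add])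
        (by intro x y; change ρ _ = ρ _ * ρ _; rw [← map_mul]; simp)
    refine ⟨ρ₂, ⟨hρ.1, ?_⟩, hx⟩
    rw [← hρ.2]
    congr 1
    ext M
    constructor
    · rintro ⟨y, rfl⟩; exact ⟨(0, y), rfl⟩
    · rintro ⟨y, rfl⟩; exact ⟨y.2, (hx y).symm⟩
  · left
    have h10 : ρ (1, 0) = 1 := by rw [← hc, h, map_one]
    have h01 : ρ (0, 1) = 0 := by rw [h10] at hsum; exact left_eq_add.mp hsum.symm
    have hz : ∀ b : B, ρ (0, b) = 0 := by
      intro b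
      have : ((0, b) : A × B) = (0, b) * (0, 1) := by simp
      rw [this, map_mul, h01, mul_zero]
    have hx : ∀ x, ρ x = ρ (x.1, 0) := fun x => by rw [hdec x, hz, add_zero]
    let ρ₁ : A →ₐ[F] Matrix (Fin n) (Fin n) (AlgebraicClosure F) :=
      AlgHom.ofLinearMap (ρ.toLinearMap.comp (LinearMap.inl F A B)) h10
        (by intro x y; change ρ _ = ρ _ * ρ _; rw [← map_mul]; simp)
    refine ⟨ρ₁, ⟨hρ.1, ?_⟩, hx⟩
    rw [← hρ.2]
    congr 1
    ext M
    constructor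
    · rintro ⟨y, rfl⟩; exact ⟨(y, 0), rfl⟩
    · rintro ⟨y, rfl⟩; exact ⟨y.1, (hx y).symm⟩

/-- The inclusion of `Z(A) × Z(B)` as the centre of `A × B`. -/
def centerProd (F A B : Type*) [Field F] [Ring A] [Algebra F A] [Ring B] [Algebra F B] :
    (Subalgebra.center F A × Subalgebra.center F B) ≃ₗ[F] Subalgebra.center F (A × B) where
  toFun z := ⟨(z.1, z.2), by
    rw [Subalgebra.center_prod]; exact ⟨z.1.2, z.2.2⟩⟩
  invFun z := (⟨(z : A × B).1, 
      ((SetLike.ext_iff.mp Subalgebra.center_prod (z : A × B)).mp z.2).1⟩,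
    ⟨(z : A × B).2, ((SetLike.ext_iff.mp Subalgebra.center_prod (z : A × B)).mp z.2).2⟩)
  map_add' _ _ := rfl
  map_smul' _ _ := rfl
  left_inv _ := rfl
  right_inv _ := rfl

theorem IsReducedTrace.prod {F A B : Type*} [Field F] [Ring A] [Algebra F A] [Ring B]
    [Algebra F B] {t : A →ₗ[F] Subalgebra.center F A} {u : B →ₗ[F] Subalgebra.center F B}
    (ht : IsReducedTrace F A t) (hu : IsReducedTrace F B u) :
    IsReducedTrace F (A × B) ((centerProd F A B).toLinearMap.comp (t.prodMap u)) := by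
  intro n ρ hρ x
  rcases hρ.factor with ⟨ρ₁, h₁, hx⟩ | ⟨ρ₂, h₂, hx⟩
  · rw [hx, hx]; exact ht n ρ₁ h₁ x.1
  · rw [hx, hx]; exact hu n ρ₂ h₂ x.2

theorem HasReducedTrace.isReducedTrace {F A : Type*} [Field F] [Ring A] [Algebra F A]
    (h : HasReducedTrace F A) : IsReducedTrace F A (reducedTrace F A) := by
  obtain ⟨t, ht⟩ := h.exists_trace
  rw [h.reducedTrace_eq ht]
  exact ht

theorem HasReducedTrace.prod {F A B : Type*} [Field F] [Ring A] [Algebra F A] [Ring B]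
    [Algebra F B] (hA : HasReducedTrace F A) (hB : HasReducedTrace F B) :
    HasReducedTrace F (A × B) := by
  refine ⟨⟨_, hA.isReducedTrace.prod hB.isReducedTrace⟩, fun x hx => ?_⟩
  refine Prod.ext (hA.faithful _ fun n ρ hρ => ?_) (hB.faithful _ fun n ρ hρ => ?_)
  · refine hx n (ρ.comp (AlgHom.fst F A B)) ⟨hρ.1, ?_⟩
    rw [← hρ.2, AlgHom.coe_comp]
    exact congrArg _ (Prod.fst_surjective.range_comp _)
  · refine hx n (ρ.comp (AlgHom.snd F A B)) ⟨hρ.1, ?_⟩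
    rw [← hρ.2, AlgHom.coe_comp]
    exact congrArg _ (Prod.snd_surjective.range_comp _)

end ReducedTrace

/-! ### Algebras with quadratic pair -/

section QuadraticPair

/-- The space `Sym(A, σ)` of symmetric elements. -/
def symElements {F A : Type*} [Field F] [Ring A] [Algebra F A] (σ : A →ₗ[F] A) : Submodule F A :=
  LinearMap.eqLocus σ LinearMap.id

theorem mem_symElements {F A : Type*} [Field F] [Ring A] [Algebra F A] {σ : A →ₗ[F] A} {a : A} :
    a ∈ symElements σ ↔ σ a = a := Iff.rfl

/-- A quadratic pair `(σ, f)` on an algebra `A` of degree `n` over its centre `Z`, where `A` is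
central simple over `Z` or a product of central simple algebras of degree `n`:
an involution `σ` that is the identity on `Z`, with `Sym(A, σ)` of dimension `n(n+1)/2` over `Z`,
and a semi-trace `f : Sym(A, σ) → Z`, that is a `Z`-linear map with
`f (x + σ x) = Trd x` for all `x`. -/
structure QuadraticPair (F : Type*) [Field F] (n : ℕ) (A : Type*) [Ring A] [Algebra F A] where
  finiteDimensional : FiniteDimensional F A
  hasReducedTrace : HasReducedTrace F A
  finrank_eq : Module.finrank F A = n ^ 2 * Module.finrank F (Subalgebra.center F A)
  σ : A →ₗ[F] A
  σ_mul : ∀ a b, σ (a * b) = σ b * σ a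
  σ_σ : ∀ a, σ (σ a) = a
  σ_center : ∀ z ∈ Subalgebra.center F A, σ z = z
  finrank_sym : 2 * Module.finrank F (symElements σ)
    = n * (n + 1) * Module.finrank F (Subalgebra.center F A)
  f : symElements σ →ₗ[F] Subalgebra.center F A
  f_center : ∀ (z : Subalgebra.center F A) (s t : symElements σ), (t : A) = z * s → f t = z * f s
  f_add_σ : ∀ (x : A) (hx : x + σ x ∈ symElements σ), f ⟨x + σ x, hx⟩ = reducedTrace F A x

namespace QuadraticPair

variable {F A B : Type*} [Field F] [Ring A] [Algebra F A] [Ring B] [Algebra F B] {n m : ℕ}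

theorem σ_one (P : QuadraticPair F n A) : P.σ 1 = 1 := P.σ_center 1 (one_mem _)

/-- An isomorphism of algebras with quadratic pair: an isomorphism of `F`-algebras compatible with
the involutions and with the semi-traces. -/
structure Iso (P : QuadraticPair F n A) (Q : QuadraticPair F m B) where
  toAlgEquiv : A ≃ₐ[F] B
  map_σ : ∀ a, toAlgEquiv (P.σ a) = Q.σ (toAlgEquiv a)
  map_f : ∀ (s : symElements P.σ) (t : symElements Q.σ), (t : B) = toAlgEquiv s →
    (Q.f t : B) = toAlgEquiv (P.f s : A)

/-- The product of two algebras with quadratic pair of the same degree. -/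
def prod (P : QuadraticPair F n A) (Q : QuadraticPair F n B) : QuadraticPair F n (A × B) where
  finiteDimensional := by
    have := P.finiteDimensional
    have := Q.finiteDimensional
    infer_instance
  hasReducedTrace := P.hasReducedTrace.prod Q.hasReducedTrace
  finrank_eq := by
    have := P.finiteDimensional
    have := Q.finiteDimensional
    rw [← (centerProd F A B).finrank_eq, Module.finrank_prod, Module.finrank_prod, P.finrank_eq,
      Q.finrank_eq, mul_add]
  σ := P.σ.prodMap Q.σ
  σ_mul a b := Prod.ext (P.σ_mul _ _) (Q.σ_mul _ _)
  σ_σ a := Prod.ext (P.σ_σ _) (Q.σ_σ _)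
  σ_center z hz := by
    rw [Subalgebra.center_prod] at hz
    exact Prod.ext (P.σ_center _ hz.1) (Q.σ_center _ hz.2)
  finrank_sym := by
    have := P.finiteDimensional
    have := Q.finiteDimensional
    let e : symElements (P.σ.prodMap Q.σ) ≃ₗ[F] symElements P.σ × symElements Q.σ :=
      { toFun := fun s => (⟨(s : A × B).1, congrArg Prod.fst s.2⟩,
          ⟨(s : A × B).2, congrArg Prod.snd s.2⟩)
        invFun := fun s => ⟨(s.1, s.2), Prod.ext s.1.2 s.2.2⟩
        map_add' := fun _ _ => rfl
        map_smul' := fun _ _ => rfl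
        left_inv := fun _ => rfl
        right_inv := fun _ => rfl }
    rw [e.finrank_eq, ← (centerProd F A B).finrank_eq, Module.finrank_prod, Module.finrank_prod,
      mul_add 2, P.finrank_sym, Q.finrank_sym, ← mul_add]
  f :=
    { toFun := fun s => centerProd F A B
        (P.f ⟨(s : A × B).1, congrArg Prod.fst s.2⟩, Q.f ⟨(s : A × B).2, congrArg Prod.snd s.2⟩)
      map_add' := fun s t => by
        rw [← map_add, Prod.mk_add_mk, ← map_add, ← map_add]; rfl
      map_smul' := fun c s => by
        rw [RingHom.id_apply, ← map_smul, Prod.smul_mk, ← map_smul, ← map_smul]; rfl }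
  f_center z s t h := by
    obtain ⟨⟨z1, z2⟩, rfl⟩ := (centerProd F A B).surjective z
    have h1 := P.f_center z1 ⟨(s : A × B).1, congrArg Prod.fst s.2⟩
      ⟨(t : A × B).1, congrArg Prod.fst t.2⟩ (congrArg Prod.fst h)
    have h2 := Q.f_center z2 ⟨(s : A × B).2, congrArg Prod.snd s.2⟩
      ⟨(t : A × B).2, congrArg Prod.snd t.2⟩ (congrArg Prod.snd h)
    apply Subtype.ext
    exact Prod.ext (congrArg Subtype.val h1) (congrArg Subtype.val h2)
  f_add_σ x hx := by
    rw [(P.hasReducedTrace.prod Q.hasReducedTrace).reducedTrace_eq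
      (P.hasReducedTrace.isReducedTrace.prod Q.hasReducedTrace.isReducedTrace)]
    have h1 := P.f_add_σ x.1 (congrArg Prod.fst hx)
    have h2 := Q.f_add_σ x.2 (congrArg Prod.snd hx)
    exact congrArg (centerProd F A B) (Prod.ext h1 h2)

/-! ### The Clifford algebra of an algebra with quadratic pair -/

/-- The sandwich map `A ⊗ A → End_F(A)`, `Sand (a ⊗ b) x = a * x * b`. -/
def sand (F A : Type*) [Field F] [Ring A] [Algebra F A] : A ⊗[F] A →ₗ[F] A →ₗ[F] A :=
  TensorProduct.lift (LinearMap.mk₂ F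
    (fun a b => (LinearMap.mulLeft F a).comp (LinearMap.mulRight F b))
    (fun a a' b => by ext x; simp [add_mul])
    (fun c a b => by ext x; simp)
    (fun a b b' => by ext x; simp [mul_add])
    (fun c a b => by ext x; simp))

@[simp] theorem sand_tmul (a b x : A) : sand F A (a ⊗ₜ b) x = a * x * b := by
  simp [sand, mul_assoc]

/-- The inclusion of `A ⊗ A` in the tensor algebra `T(A)`. -/
def tensorSquare (F A : Type*) [Field F] [Ring A] [Algebra F A] :
    A ⊗[F] A →ₗ[F] TensorAlgebra F A :=
  TensorProduct.lift
    ((LinearMap.mul F (TensorAlgebra F A)).compl₁₂ (TensorAlgebra.ι F) (TensorAlgebra.ι F))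

@[simp] theorem tensorSquare_tmul (a b : A) :
    tensorSquare F A (a ⊗ₜ b) = TensorAlgebra.ι F a * TensorAlgebra.ι F b := rfl

/-- The element `ℓ` of `A` determines the semi-trace `f`: `ℓ + σ ℓ = 1` and `f s = Trd (ℓ s)`. -/
def Determines (P : QuadraticPair F n A) (ℓ : A) : Prop :=
  ℓ + P.σ ℓ = 1 ∧ ∀ s : symElements P.σ, P.f s = reducedTrace F A (ℓ * s)

/-- Invariance of `u ∈ A ⊗ A` under the map `σ₂`, which is defined by
`Sand (σ₂ u) x = Sand u (σ x)`. Recall that `Sand` is injective if `A` is central simple. -/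
def IsSigmaTwoInvariant (P : QuadraticPair F n A) (u : A ⊗[F] A) : Prop :=
  ∀ x, sand F A u (P.σ x) = sand F A u x

/-- The relations defining the Clifford algebra as a quotient of the tensor algebra `T(A)`:
`s = f s` for symmetric `s` (the centre of `A` is `F`, so that `f s` is a scalar `r`), and
`u = Sand u ℓ` for `σ₂`-invariant `u ∈ A ⊗ A`, where `ℓ` determines `f`. Such an `ℓ` exists, and
`Sand u ℓ` is the same for all of them. -/
inductive CliffordRel (P : QuadraticPair F n A) : TensorAlgebra F A → TensorAlgebra F A → Prop
  | sym (s : symElements P.σ) (r : F) (h : (P.f s : A) = algebraMap F A r) :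
      CliffordRel P (TensorAlgebra.ι F (s : A)) (algebraMap F (TensorAlgebra F A) r)
  | sandwich (u : A ⊗[F] A) (hu : P.IsSigmaTwoInvariant u) (ℓ : A) (hℓ : P.Determines ℓ) :
      CliffordRel P (tensorSquare F A u) (TensorAlgebra.ι F (sand F A u ℓ))

/-- The Clifford algebra `C(A, σ, f)` of an `F`-central simple algebra with quadratic pair: the
quotient of `T(A)` by the two-sided ideal generated by the above relations. -/
def Clifford [Algebra.IsCentral F A] (P : QuadraticPair F n A) : Type _ :=
  RingQuot P.CliffordRel

section Clifford

variable [Algebra.IsCentral F A] (P : QuadraticPair F n A)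

instance : Ring P.Clifford := inferInstanceAs (Ring (RingQuot P.CliffordRel))

instance : Algebra F P.Clifford := inferInstanceAs (Algebra F (RingQuot P.CliffordRel))

/-- The quotient map `T(A) → C(A, σ, f)`. -/
def toClifford : TensorAlgebra F A →ₐ[F] P.Clifford := RingQuot.mkAlgHom F P.CliffordRel

/-- The canonical map `c : A → C(A, σ, f)`. -/
def c : A →ₗ[F] P.Clifford := P.toClifford.toLinearMap.comp (TensorAlgebra.ι F)

theorem c_sym (s : symElements P.σ) (r : F) (h : (P.f s : A) = algebraMap F A r) :
    P.c s = algebraMap F P.Clifford r := by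
  have := RingQuot.mkAlgHom_rel F (CliffordRel.sym (P := P) s r h)
  rw [AlgHom.commutes] at this
  exact this

theorem toClifford_tensorSquare (u : A ⊗[F] A) (hu : P.IsSigmaTwoInvariant u) (ℓ : A)
    (hℓ : P.Determines ℓ) : P.toClifford (tensorSquare F A u) = P.c (sand F A u ℓ) :=
  RingQuot.mkAlgHom_rel F (CliffordRel.sandwich u hu ℓ hℓ)

/-- The anti-homomorphism `T(A) → C(A, σ, f)` extending `a ↦ c (σ a)`. -/
def tensorInvolution : TensorAlgebra F A →ₐ[F] P.Cliffordᵐᵒᵖ :=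
  TensorAlgebra.lift F
    ((MulOpposite.opLinearEquiv F : P.Clifford ≃ₗ[F] P.Cliffordᵐᵒᵖ).toLinearMap.comp
      (P.c.comp P.σ))

theorem tensorInvolution_ι (a : A) :
    P.tensorInvolution (TensorAlgebra.ι F a) = MulOpposite.op (P.c (P.σ a)) := by
  simp [tensorInvolution]

theorem tensorInvolution_rel {x y : TensorAlgebra F A} (h : P.CliffordRel x y) :
    P.tensorInvolution x = P.tensorInvolution y := by
  -- `w` is the reflection of `u`, with `Sand w x = σ (Sand u (σ x))`
  let w : A ⊗[F] A →ₗ[F] A ⊗[F] A :=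
    (TensorProduct.map P.σ P.σ).comp (TensorProduct.comm F A A).toLinearMap
  have hw1 : ∀ u x, sand F A (w u) x = P.σ (sand F A u (P.σ x)) := by
    intro u x
    induction u using TensorProduct.induction_on with
    | zero => simp
    | tmul a b =>
      change sand F A (P.σ b ⊗ₜ P.σ a) x = _
      simp [P.σ_mul, P.σ_σ, mul_assoc]
    | add u v hu hv => simp only [map_add, LinearMap.add_apply, hu, hv]
  have hw2 : ∀ u, P.tensorInvolution (tensorSquare F A u)
      = MulOpposite.op (P.toClifford (tensorSquare F A (w u))) := by
    intro u
    induction u using TensorProduct.induction_on with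
    | zero => simp
    | tmul a b =>
      change _ = MulOpposite.op (P.toClifford (tensorSquare F A (P.σ b ⊗ₜ P.σ a)))
      rw [tensorSquare_tmul, tensorSquare_tmul, map_mul, map_mul, tensorInvolution_ι,
        tensorInvolution_ι, ← MulOpposite.op_mul]
      rfl
    | add u v hu hv => simp only [map_add, MulOpposite.op_add, hu, hv]
  cases h with
  | sym s r h =>
    rw [tensorInvolution_ι, AlgHom.commutes, mem_symElements.mp s.2, P.c_sym s r h]
    rfl
  | sandwich u hu ℓ hℓ =>
    have hwu : P.IsSigmaTwoInvariant (w u) := by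
      intro x
      rw [hw1, hw1, P.σ_σ, hu x]
    rw [hw2, P.toClifford_tensorSquare (w u) hwu ℓ hℓ, hw1, hu, tensorInvolution_ι]

/-- The canonical involution on `C(A, σ, f)`, as a linear map: it is the anti-automorphism with
`a₁ ⋯ aᵣ ↦ σ(aᵣ) ⋯ σ(a₁)` for `a₁, …, aᵣ` in the image of `A`. -/
def canonicalInvolution : P.Clifford →ₗ[F] P.Clifford :=
  (MulOpposite.opLinearEquiv F : P.Clifford ≃ₗ[F] P.Cliffordᵐᵒᵖ).symm.toLinearMap.comp
    (RingQuot.liftAlgHom F ⟨P.tensorInvolution, fun _ _ h => P.tensorInvolution_rel h⟩ :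
      RingQuot P.CliffordRel →ₐ[F] P.Cliffordᵐᵒᵖ).toLinearMap

theorem canonicalInvolution_toClifford (x : TensorAlgebra F A) :
    P.canonicalInvolution (P.toClifford x) = MulOpposite.unop (P.tensorInvolution x) := by
  change MulOpposite.unop (RingQuot.liftAlgHom F _ (RingQuot.mkAlgHom F P.CliffordRel x)) = _
  rw [RingQuot.liftAlgHom_mkAlgHom_apply]

theorem canonicalInvolution_c (a : A) : P.canonicalInvolution (P.c a) = P.c (P.σ a) := by
  change P.canonicalInvolution (P.toClifford (TensorAlgebra.ι F a)) = _
  rw [canonicalInvolution_toClifford, tensorInvolution_ι, MulOpposite.unop_op]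

theorem canonicalInvolution_mul (x y : P.Clifford) : P.canonicalInvolution (x * y)
    = P.canonicalInvolution y * P.canonicalInvolution x := by
  obtain ⟨x, rfl⟩ := RingQuot.mkAlgHom_surjective F P.CliffordRel x
  obtain ⟨y, rfl⟩ := RingQuot.mkAlgHom_surjective F P.CliffordRel y
  change P.canonicalInvolution (P.toClifford x * P.toClifford y)
    = P.canonicalInvolution (P.toClifford y) * P.canonicalInvolution (P.toClifford x)
  rw [← map_mul, canonicalInvolution_toClifford, map_mul, MulOpposite.unop_mul,
    canonicalInvolution_toClifford, canonicalInvolution_toClifford]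

/-- The quadratic pair `R` on `C(A, σ, f)` is the canonical one: its involution is the canonical
involution, and its semi-trace is `s ↦ Trd (c(λ) s)`, for each `λ ∈ A` of reduced trace `1`. -/
structure IsCanonical (R : QuadraticPair F m P.Clifford) : Prop where
  exists_trace_one : ∃ l : A, reducedTrace F A l = 1
  σ_eq : R.σ = P.canonicalInvolution
  f_eq : ∀ l : A, reducedTrace F A l = 1 →
    ∀ s : symElements R.σ, R.f s = reducedTrace F P.Clifford (P.c l * s)

end Clifford

end QuadraticPair

end QuadraticPair

/-! ### The adjoint quadratic pair of a nonsingular quadratic form -/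

section Adjoint

/-- A quadratic form on a finite-dimensional space is nonsingular if its polar form
`b_q(x, y) = q (x + y) - q x - q y` is nondegenerate. -/
structure IsNonsingularForm {F V : Type*} [Field F] [AddCommGroup V] [Module F V]
    (q : QuadraticForm F V) : Prop where
  finiteDimensional : FiniteDimensional F V
  nondegenerate : LinearMap.BilinForm.Nondegenerate q.polarBilin

/-- A bilinear form `β` with `β x x = q x`. -/
def bilinOf {F V : Type*} [Field F] [AddCommGroup V] [Module F V] (q : QuadraticForm F V) :
    LinearMap.BilinForm F V :=
  (LinearMap.BilinMap.toQuadraticMap_surjective q).choose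

theorem bilinOf_self {F V : Type*} [Field F] [AddCommGroup V] [Module F V]
    (q : QuadraticForm F V) (x : V) : bilinOf q x x = q x :=
  DFunLike.congr_fun (LinearMap.BilinMap.toQuadraticMap_surjective q).choose_spec x

theorem bilinOf_add_flip {F V : Type*} [Field F] [AddCommGroup V] [Module F V]
    (q : QuadraticForm F V) (x y : V) : bilinOf q x y + bilinOf q y x = q.polarBilin x y := by
  rw [QuadraticMap.polarBilin_apply_apply, QuadraticMap.polar, ← bilinOf_self, ← bilinOf_self,
    ← bilinOf_self]
  simp only [map_add, LinearMap.add_apply]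
  ring

variable {F V : Type*} [Field F] [AddCommGroup V] [Module F V]

theorem finrank_center_end (F V : Type*) [Field F] [AddCommGroup V] [Module F V] [Nontrivial V] :
    Module.finrank F (Subalgebra.center F (Module.End F V)) = 1 := by
  rw [Algebra.IsCentral.center_eq_bot]
  exact Subalgebra.finrank_bot

theorem polarBilin_symm (q : QuadraticForm F V) (x y : V) :
    q.polarBilin x y = q.polarBilin y x := by
  simp only [QuadraticMap.polarBilin_apply_apply]
  exact QuadraticMap.polar_comm _ _ _

/-- The standard identification `φ_q : V ⊗ V → End_F(V)`, `φ_q (x ⊗ y) z = b_q(y, z) x`,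
on pure tensors. -/
def standardEnd (q : QuadraticForm F V) (x y : V) : Module.End F V :=
  (q.polarBilin y).smulRight x

namespace IsNonsingularForm

variable {q : QuadraticForm F V} (hq : IsNonsingularForm q)

/-- The isomorphism `V ≃ V*` given by the polar form. -/
def polarDual : V ≃ₗ[F] Module.Dual F V :=
  haveI := hq.finiteDimensional
  LinearMap.BilinForm.toDual q.polarBilin hq.nondegenerate

theorem polarDual_apply (x y : V) : hq.polarDual x y = q.polarBilin x y := rfl

theorem polarBilin_polarDual_symm (g : Module.Dual F V) (y : V) :
    q.polarBilin (hq.polarDual.symm g) y = g y := by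
  rw [← hq.polarDual_apply, LinearEquiv.apply_symm_apply]

theorem ext_left {q : QuadraticForm F V} (hq : IsNonsingularForm q) {x y : V} (h : ∀ z, q.polarBilin x z = q.polarBilin y z) : x = y :=
  hq.polarDual.injective (LinearMap.ext h)

/-- The adjoint involution `σ_q` on `End_F(V)`: `b_q(σ_q(a) x, y) = b_q(x, a y)`. -/
def adjointInvolution : Module.End F V →ₗ[F] Module.End F V where
  toFun a := hq.polarDual.symm.toLinearMap ∘ₗ Module.Dual.transpose a ∘ₗ hq.polarDual.toLinearMap
  map_add' a b := by ext x; simp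
  map_smul' c a := by ext x; simp

theorem polarBilin_adjoint_left (a : Module.End F V) (x y : V) :
    q.polarBilin (hq.adjointInvolution a x) y = q.polarBilin x (a y) :=
  hq.polarBilin_polarDual_symm _ y

theorem polarBilin_adjoint_right (a : Module.End F V) (x y : V) :
    q.polarBilin x (hq.adjointInvolution a y) = q.polarBilin (a x) y := by
  rw [polarBilin_symm, polarBilin_adjoint_left, polarBilin_symm]

theorem trace_adjoint (a : Module.End F V) :
    LinearMap.trace F V (hq.adjointInvolution a) = LinearMap.trace F V a := by
  have := hq.finiteDimensional
  have h : hq.adjointInvolution a = hq.polarDual.symm.conj (Module.Dual.transpose a) := by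
    ext x; rfl
  rw [h, LinearMap.trace_conj', LinearMap.trace_transpose']

theorem adjoint_mul (a b : Module.End F V) : hq.adjointInvolution (a * b)
    = hq.adjointInvolution b * hq.adjointInvolution a := by
  ext x
  refine hq.ext_left fun z => ?_
  simp only [Module.End.mul_apply, polarBilin_adjoint_left]

theorem adjoint_adjoint (a : Module.End F V) :
    hq.adjointInvolution (hq.adjointInvolution a) = a := by
  ext x
  refine hq.ext_left fun z => ?_
  rw [polarBilin_adjoint_left, polarBilin_adjoint_right]

/-- An endomorphism `ℓ` with `b_q(ℓ x, y) = β(x, y)`, where `β x x = q x`. -/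
def ell : Module.End F V := hq.polarDual.symm.toLinearMap ∘ₗ bilinOf q

theorem polarBilin_ell (x y : V) : q.polarBilin (hq.ell x) y = bilinOf q x y :=
  hq.polarBilin_polarDual_symm _ y

theorem ell_add_adjoint : hq.ell + hq.adjointInvolution hq.ell = 1 := by
  ext x
  refine hq.ext_left fun z => ?_
  rw [LinearMap.add_apply, map_add, LinearMap.add_apply, polarBilin_adjoint_left, polarBilin_ell,
    polarBilin_symm q x, polarBilin_ell, bilinOf_add_flip]
  rfl

/-- Symmetric endomorphisms correspond to functions on unordered pairs of basis elements. -/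
def symEquiv : symElements hq.adjointInvolution
    ≃ₗ[F] (Sym2 (Fin (Module.finrank F V)) → F) :=
  haveI := hq.finiteDimensional
  let b := Module.finBasis F V
  let G : Module.End F V ≃ₗ[F] (V →ₗ[F] Module.Dual F V) := hq.polarDual.congrRight
  have hG : ∀ (a : Module.End F V) (x y : V), G a x y = q.polarBilin (a x) y := fun _ _ _ => rfl
  have hsym : ∀ a : Module.End F V, hq.adjointInvolution a = a ↔ ∀ i j, G a (b i) (b j)
      = G a (b j) (b i) := by
    intro a
    have h1 : hq.adjointInvolution a = a ↔ G a = LinearMap.flip (G a) := by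
      constructor
      · intro h
        ext x y
        rw [LinearMap.flip_apply, hG, hG, polarBilin_symm q (a y), ← hq.polarBilin_adjoint_left, h]
      · intro h
        ext x
        refine hq.ext_left fun z => ?_
        have := LinearMap.congr_fun₂ h x z
        rw [LinearMap.flip_apply, hG, hG] at this
        rw [polarBilin_adjoint_left, this, polarBilin_symm]
    rw [h1]
    constructor
    · intro h i j
      conv_lhs => rw [h]
      rfl
    · intro h
      exact b.ext fun i => b.ext fun j => h i j
  { toFun := fun a => Sym2.lift ⟨fun i j => G a (b i) (b j), (hsym a).mp a.2⟩
    map_add' := fun a a' => by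
      ext z; induction z using Sym2.ind; simp
    map_smul' := fun c a => by
      ext z; induction z using Sym2.ind; simp
    invFun := fun g => ⟨G.symm (b.constr F fun i => b.constr F fun j => g s(i, j)), by
      rw [mem_symElements, hsym]
      intro i j
      simp [Sym2.eq_swap]⟩
    left_inv := fun a => by
      apply Subtype.ext
      apply G.injective
      refine b.ext fun i => b.ext fun j => ?_
      simp
    right_inv := fun g => by
      ext z; induction z using Sym2.ind; simp }

/-- The algebra with quadratic pair `Ad_q = (End_F(V), σ_q, f_q)`. Its semi-trace `f_q` is
characterised by `f_q (φ_q (x ⊗ x)) = q x`, see `Ad_f_standardEnd`. -/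
def Ad : QuadraticPair F (Module.finrank F V) (Module.End F V) where
  finiteDimensional := by
    have := hq.finiteDimensional
    infer_instance
  hasReducedTrace := by
    have := hq.finiteDimensional
    exact hasReducedTrace_end F V
  finrank_eq := by
    have := hq.finiteDimensional
    rcases subsingleton_or_nontrivial V with h | h
    · rw [Module.finrank_zero_of_subsingleton, Module.finrank_zero_of_subsingleton (M := V)]
      simp
    · rw [finrank_center_end F V, Module.finrank_linearMap]; ring
  σ := hq.adjointInvolution
  σ_mul := hq.adjoint_mul
  σ_σ := hq.adjoint_adjoint
  σ_center z hz := by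
    obtain ⟨r, rfl⟩ := Algebra.IsCentral.mem_center_iff F |>.mp hz
    ext x
    refine hq.ext_left fun z => ?_
    rw [polarBilin_adjoint_left]
    simp [Module.algebraMap_end_apply]
  finrank_sym := by
    have := hq.finiteDimensional
    rcases subsingleton_or_nontrivial V with h | h
    · rw [Module.finrank_zero_of_subsingleton, Module.finrank_zero_of_subsingleton (M := V)]
      simp
    · rw [finrank_center_end F V, hq.symEquiv.finrank_eq, Module.finrank_fintype_fun_eq_card,
        Sym2.card, Fintype.card_fin, mul_one, mul_comm, Nat.choose_two_right,
        Nat.div_mul_cancel (Nat.even_mul_pred_self _).two_dvd]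
      simp [mul_comm]
  f := (endTrace F V).comp ((LinearMap.mulLeft F hq.ell).comp (Submodule.subtype _))
  f_center z s t h := by
    obtain ⟨r, hr⟩ := Algebra.IsCentral.mem_center_iff F |>.mp z.2
    apply Subtype.ext
    change algebraMap F (Module.End F V) (LinearMap.trace F V (hq.ell * t))
      = z * algebraMap F (Module.End F V) (LinearMap.trace F V (hq.ell * s))
    rw [h, hr, ← map_mul, ← Algebra.smul_def, mul_smul_comm, map_smul, smul_eq_mul]
  f_add_σ x hx := by
    have := hq.finiteDimensional
    apply Subtype.ext
    rw [coe_reducedTrace_end]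
    change algebraMap F (Module.End F V)
      (LinearMap.trace F V (hq.ell * (x + hq.adjointInvolution x))) = _
    congr 1
    have h : LinearMap.trace F V (hq.ell * hq.adjointInvolution x)
        = LinearMap.trace F V (hq.adjointInvolution hq.ell * x) := by
      rw [← hq.trace_adjoint, hq.adjoint_mul, hq.adjoint_adjoint, LinearMap.trace_mul_comm]
    rw [mul_add, map_add, h, ← map_add, ← add_mul, hq.ell_add_adjoint, one_mul]

theorem Ad_f_standardEnd (x : V) (hx : standardEnd q x x ∈ symElements hq.Ad.σ) :
    (hq.Ad.f ⟨standardEnd q x x, hx⟩ : Module.End F V) = algebraMap F _ (q x) := by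
  have := hq.finiteDimensional
  change algebraMap F (Module.End F V) (LinearMap.trace F V (hq.ell * standardEnd q x x)) = _
  congr 1
  have h : hq.ell * standardEnd q x x = (q.polarBilin x).smulRight (hq.ell x) := by
    ext z; simp [standardEnd]
  rw [h, LinearMap.trace_smulRight, polarBilin_symm, polarBilin_ell, bilinOf_self]

theorem standardEnd_mem_symElements (x : V) : standardEnd q x x ∈ symElements hq.Ad.σ := by
  change hq.adjointInvolution (standardEnd q x x) = standardEnd q x x
  ext y
  refine hq.ext_left fun z => ?_
  rw [polarBilin_adjoint_left]
  simp only [standardEnd, LinearMap.smulRight_apply, map_smul, LinearMap.smul_apply, smul_eq_mul]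
  rw [polarBilin_symm q y x, mul_comm]

end IsNonsingularForm

end Adjoint

/-! ### Pfister forms -/

section Pfister

/-- The tensor product `b ⊗ q` of a bilinear form and a quadratic form: for symmetric `b`, it is
the quadratic form with `(b ⊗ q)(w ⊗ v) = b(w, w) q(v)` and polar form `b ⊗ b_q`. -/
def tensorForm {F V W : Type*} [Field F] [AddCommGroup V] [Module F V] [AddCommGroup W]
    [Module F W] (b : LinearMap.BilinForm F W) (q : QuadraticForm F V) :
    QuadraticForm F (W ⊗[F] V) :=
  LinearMap.BilinMap.toQuadraticMap (b.tmul (bilinOf q))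

theorem tensorForm_tmul {F V W : Type*} [Field F] [AddCommGroup V] [Module F V] [AddCommGroup W]
    [Module F W] (b : LinearMap.BilinForm F W) (q : QuadraticForm F V) (w : W) (v : V) :
    tensorForm b q (w ⊗ₜ v) = b w w * q v := by
  rw [mul_comm, ← bilinOf_self q]; rfl

theorem polarBilin_tensorForm {F V W : Type*} [Field F] [AddCommGroup V] [Module F V]
    [AddCommGroup W] [Module F W] (b : LinearMap.BilinForm F W) (hb : LinearMap.IsSymm b)
    (q : QuadraticForm F V) : (tensorForm b q).polarBilin = b.tmul q.polarBilin := by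
  rw [tensorForm, LinearMap.BilinMap.polarBilin_toQuadraticMap]
  ext w v w' v'
  change bilinOf q v v' * b w w' + bilinOf q v' v * b w' w = q.polarBilin v v' * b w w'
  have h : b w' w = b w w' := hb.eq w' w
  rw [← bilinOf_add_flip, h]
  ring

theorem tmul_nondegenerate {F V W : Type*} [Field F] [AddCommGroup V] [Module F V]
    [AddCommGroup W] [Module F W] [FiniteDimensional F V] [FiniteDimensional F W]
    {b : LinearMap.BilinForm F W} {c : LinearMap.BilinForm F V} (hb : b.Nondegenerate)
    (hc : c.Nondegenerate) (hb' : LinearMap.IsSymm b) (hc' : LinearMap.IsSymm c) :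
    (b.tmul c).Nondegenerate := by
  let e : W ⊗[F] V ≃ₗ[F] Module.Dual F (W ⊗[F] V) :=
    (TensorProduct.congr (b.toDual hb) (c.toDual hc)).trans (TensorProduct.dualDistribEquiv F W V)
  have he : b.tmul c = e.toLinearMap := by
    ext w v w' v'
    exact mul_comm _ _
  rw [(LinearMap.IsSymm.tmul hb' hc').isRefl.nondegenerate_iff_separatingLeft,
    LinearMap.separatingLeft_iff_ker_eq_bot, he]
  exact e.ker

theorem isNonsingularForm_tensorForm {F V W : Type*} [Field F] [AddCommGroup V] [Module F V]
    [AddCommGroup W] [Module F W] [FiniteDimensional F W] {b : LinearMap.BilinForm F W}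
    (hb : b.Nondegenerate) (hb' : LinearMap.IsSymm b) {q : QuadraticForm F V}
    (hq : IsNonsingularForm q) : IsNonsingularForm (tensorForm b q) := by
  have := hq.finiteDimensional
  refine ⟨inferInstance, ?_⟩
  rw [polarBilin_tensorForm b hb']
  exact tmul_nondegenerate hb hq.nondegenerate hb' ⟨polarBilin_symm q⟩

theorem IsNonsingularForm.of_isometryEquiv {F V W : Type*} [Field F] [AddCommGroup V]
    [Module F V] [AddCommGroup W] [Module F W] {q : QuadraticForm F V} {q' : QuadraticForm F W}
    (hq' : IsNonsingularForm q') (e : q.IsometryEquiv q') : IsNonsingularForm q := by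
  have hp : ∀ x y, q.polarBilin x y = q'.polarBilin (e.toLinearEquiv x) (e.toLinearEquiv y) := by
    intro x y
    simp only [QuadraticMap.polarBilin_apply_apply, QuadraticMap.polar]
    rw [← map_add]
    exact congrArg₂ _ (congrArg₂ _ (e.map_app _).symm (e.map_app _).symm) (e.map_app _).symm
  have := hq'.finiteDimensional
  refine ⟨e.toLinearEquiv.symm.finiteDimensional, ?_, ?_⟩
  · intro x hx
    apply e.toLinearEquiv.injective
    rw [map_zero]
    refine hq'.nondegenerate.1 _ fun y => ?_
    obtain ⟨y, rfl⟩ := e.toLinearEquiv.surjective y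
    rw [← hx y, hp]
  · intro x hx
    apply e.toLinearEquiv.injective
    rw [map_zero]
    refine hq'.nondegenerate.2 _ fun y => ?_
    obtain ⟨y, rfl⟩ := e.toLinearEquiv.surjective y
    rw [← hx y, hp]

/-- A binary symmetric bilinear form representing `1`. -/
structure IsBinaryRepresentingOne {F : Type*} [Field F]
    (b : LinearMap.BilinForm F (Fin 2 → F)) : Prop where
  isSymm : b.IsSymm
  represents_one : ∃ v, b v v = 1

/-- `π` is a `3`-fold quadratic Pfister form: it is isometric to the tensor product of a `2`-fold
bilinear Pfister form, that is a nondegenerate tensor product of two binary symmetric bilinear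
forms representing `1`, and a nonsingular binary quadratic form representing `1`. -/
def IsThreefoldPfisterForm {F V : Type*} [Field F] [AddCommGroup V] [Module F V]
    (π : QuadraticForm F V) : Prop :=
  ∃ (b₁ b₂ : LinearMap.BilinForm F (Fin 2 → F)) (φ : QuadraticForm F (Fin 2 → F)),
    IsBinaryRepresentingOne b₁ ∧ IsBinaryRepresentingOne b₂ ∧ (b₁.tmul b₂).Nondegenerate ∧
    IsNonsingularForm φ ∧ (∃ v, φ v = 1) ∧
    Nonempty (π.IsometryEquiv (tensorForm (b₁.tmul b₂) φ))

theorem IsThreefoldPfisterForm.isNonsingularForm {F V : Type*} [Field F] [AddCommGroup V]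
    [Module F V] {π : QuadraticForm F V} (hπ : IsThreefoldPfisterForm π) :
    IsNonsingularForm π := by
  obtain ⟨b₁, b₂, φ, h₁, h₂, hb, hφ, -, ⟨e⟩⟩ := hπ
  exact (isNonsingularForm_tensorForm hb (LinearMap.IsSymm.tmul
    (LinearMap.BilinForm.isSymm_iff.mp h₁.isSymm)
    (LinearMap.BilinForm.isSymm_iff.mp h₂.isSymm)) hφ).of_isometryEquiv e

end Pfister

end

/-! The proof is triality for the para-octonion product. A 3-fold Pfister form `π` is the norm form
of an octonion algebra: its three factors are the three steps of the Cayley–Dickson process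
(`IsThreefoldPfisterForm.exists_octonion`). The product `x * y = x̄ ȳ` is then a symmetric
composition: `(x * y) * x = π(x) y = x * (y * x)`, and the polar form is associative.

Write `l_x`, `r_x` for left and right multiplication. Since `l_x r_x = r_x l_x = π(x)`, the pairs
`(l_x r_y, r_x l_y)` satisfy the two relations of an even Clifford map. Under `V ⊗ V ≃ End(V)` the
relations of the Clifford algebra of `Ad_π` become exactly these two: symmetric elements are
controlled by the tensors `x ⊗ x`, and `σ₂`-invariant ones by `x ⊗ y ⊗ y ⊗ w` (`lift_cliffordRel`).
Hence there is a homomorphism from the Clifford algebra to `End(V) × End(V)`.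

It is bijective by counting. Fix a basis with `π(e₀) = 1`. The Clifford algebra is spanned by the
`2^7` ordered products of the elements `c(e₀ ⊗ eᵢ)`, `i > 0`; the images of these products are
independent, as twisted derivations show (`finrank_orderedSpan`); and the target has dimension `2 ·
8² = 2^7`.

Associativity of the polar form says that `l_x` and `r_x` are adjoint to each other, which matches
the involutions. If `c(a)` goes to `(d₁, d₂)`, then `b(z, dᵢ z) = tr(a) π(z)` for all `z`, so `tr(dᵢ
s) = tr(a) f_π(s)` for symmetric `s` (`trace_evenMap_mul`). For `tr(a) = 1` this is the semi-trace
of `Ad_π × Ad_π`, whatever the choice of `a`. No step divides by 2. -/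

noncomputable section

/-! ### Ordered products of generators: spanning and independence -/

section OrderedSpan

variable {F R S : Type*} [Field F] [Ring R] [Algebra F R] [Ring S] [Algebra F S]

/-- The span of the products `v i₁ * ⋯ * v iᵣ` with `k > i₁ > ⋯ > iᵣ`. -/
def orderedSpan (F : Type*) {R : Type*} [Field F] [Ring R] [Algebra F R] (v : ℕ → R) :
    ℕ → Submodule F R
  | 0 => Submodule.span F {1}
  | k + 1 => orderedSpan F v k ⊔ (orderedSpan F v k).map (LinearMap.mulLeft F (v k))

theorem mem_orderedSpan_succ {v : ℕ → R} {k : ℕ} {x : R} :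
    x ∈ orderedSpan F v (k + 1) ↔
      ∃ a ∈ orderedSpan F v k, ∃ b ∈ orderedSpan F v k, a + v k * b = x := by
  simp [orderedSpan, Submodule.mem_sup]

theorem one_mem_orderedSpan (v : ℕ → R) (k : ℕ) : (1 : R) ∈ orderedSpan F v k := by
  induction k with
  | zero => exact Submodule.mem_span_singleton_self _
  | succ k ih => exact (le_sup_left : _ ≤ orderedSpan F v (k + 1)) ih

theorem map_orderedSpan (φ : R →ₐ[F] S) (v : ℕ → R) (k : ℕ) :
    (orderedSpan F v k).map φ.toLinearMap = orderedSpan F (fun i => φ (v i)) k := by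
  induction k with
  | zero => simp [orderedSpan, Submodule.map_span]
  | succ k ih =>
    rw [orderedSpan, orderedSpan, Submodule.map_sup, ih, ← ih, ← Submodule.map_comp,
      ← Submodule.map_comp]
    congr 2
    ext x
    simp

instance finiteDimensional_orderedSpan (v : ℕ → R) (k : ℕ) :
    FiniteDimensional F (orderedSpan F v k) := by
  induction k with
  | zero => rw [orderedSpan]; infer_instance
  | succ k ih => rw [orderedSpan]; infer_instance

theorem finrank_orderedSpan_le (v : ℕ → R) (k : ℕ) :
    Module.finrank F (orderedSpan F v k) ≤ 2 ^ k := by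
  induction k with
  | zero => exact (finrank_span_le_card _).trans (by simp)
  | succ k ih =>
    refine (Submodule.finrank_add_le_finrank_add_finrank _ _).trans ?_
    have := Submodule.finrank_map_le (LinearMap.mulLeft F (v k)) (orderedSpan F v k)
    rw [pow_succ]
    omega

/-- The relations straighten products. Moving `v j` past the leading factor `v k` costs only terms
with fewer factors, and leaves `v j` acting on the smaller span, where induction applies; for `j =
k` the quadratic equation of `v k` removes the square. -/
theorem mul_mem_orderedSpan {v : ℕ → R} {n : ℕ}
    (hv : ∀ i < n, ∃ α β : F, v i * v i = α • 1 + β • v i)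
    (hvv : ∀ i < n, ∀ j < n, ∃ α β γ : F,
      v i * v j = α • 1 + β • v i + γ • v j - v j * v i) :
    ∀ k ≤ n, ∀ j < k, ∀ x ∈ orderedSpan F v k, v j * x ∈ orderedSpan F v k := by
  intro k
  induction k with
  | zero => intro _ j hj; omega
  | succ k ih =>
    intro hk j hj x hx
    have hle : orderedSpan F v k ≤ orderedSpan F v (k + 1) := le_sup_left
    have hmul : ∀ y ∈ orderedSpan F v k, v k * y ∈ orderedSpan F v (k + 1) := fun y hy =>
      mem_orderedSpan_succ.mpr ⟨0, zero_mem _, y, hy, zero_add _⟩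
    obtain ⟨a, ha, b, hb, rfl⟩ := mem_orderedSpan_succ.mp hx
    rw [mul_add, ← mul_assoc]
    rcases Nat.lt_succ_iff_lt_or_eq.mp hj with hjk | rfl
    · have ih' := ih (by omega) j hjk
      obtain ⟨α, β, γ, h⟩ := hvv j (by omega) k (by omega)
      rw [h, sub_mul, add_mul, add_mul, mul_assoc (v k), smul_mul_assoc, smul_mul_assoc,
        smul_mul_assoc, one_mul]
      exact add_mem (hle (ih' a ha)) (sub_mem (add_mem (add_mem
        (Submodule.smul_mem _ _ (hle hb)) (Submodule.smul_mem _ _ (hle (ih' b hb))))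
        (Submodule.smul_mem _ _ (hmul b hb))) (hmul _ (ih' b hb)))
    · obtain ⟨α, β, h⟩ := hv j (by omega)
      rw [h, add_mul, smul_mul_assoc, smul_mul_assoc, one_mul]
      exact add_mem (hmul a ha) (add_mem (Submodule.smul_mem _ _ (hle hb))
        (Submodule.smul_mem _ _ (hmul b hb)))

/-- The twisted derivations `x ↦ w i * x - τ x * w i` show that the ordered products are
linearly independent. -/
theorem finrank_orderedSpan [Nontrivial R] {v w : ℕ → R} {n : ℕ} (τ : R →ₐ[F] R)
    (hw : ∀ i < n, ∀ j < n, w i * v j - τ (v j) * w i = if i = j then -1 else 0) :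
    ∀ k ≤ n, Module.finrank F (orderedSpan F v k) = 2 ^ k := by
  -- `D i x = w i * x - τ x * w i` satisfies `D i (x * y) = D i x * y + τ x * D i y` and `D i 1 =
  -- 0`. So it kills every product of factors `v j` with `j < k ≤ i`.
  have hD : ∀ k ≤ n, ∀ i < n, k ≤ i → ∀ x ∈ orderedSpan F v k, w i * x - τ x * w i = 0 := by
    intro k
    induction k with
    | zero =>
      intro _ i _ _ x hx
      obtain ⟨r, rfl⟩ := Submodule.mem_span_singleton.mp hx
      simp
    | succ k ih =>
      intro hk i hi hki x hx
      obtain ⟨a, ha, b, hb, rfl⟩ := mem_orderedSpan_succ.mp hx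
      have h1 := ih (by omega) i hi (by omega) a ha
      have h2 := ih (by omega) i hi (by omega) b hb
      have h3 := hw i hi k (by omega)
      rw [if_neg (by omega)] at h3
      calc w i * (a + v k * b) - τ (a + v k * b) * w i
          = (w i * a - τ a * w i) + (w i * v k - τ (v k) * w i) * b
            + τ (v k) * (w i * b - τ b * w i) := by rw [map_add, map_mul]; noncomm_ring
        _ = 0 := by rw [h1, h2, h3]; simp
  intro k
  induction k with
  | zero => intro _; exact finrank_span_singleton one_ne_zero
  | succ k ih =>
    intro hk
    -- Apply `D k` to the relation: `a` and `b` are killed and `D k (v k) = -1`, so that `-b = 0`.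
    -- Hence left multiplication by `v k` is injective on the span and its image meets the span
    -- trivially, which doubles the dimension.
    have key : ∀ a ∈ orderedSpan F v k, ∀ b ∈ orderedSpan F v k, a + v k * b = 0 → b = 0 := by
      intro a ha b hb h
      have h1 := hD k (by omega) k (by omega) le_rfl a ha
      have h2 := hD k (by omega) k (by omega) le_rfl b hb
      have h3 := hw k (by omega) k (by omega)
      rw [if_pos rfl] at h3
      have h4 : w k * (a + v k * b) - τ (a + v k * b) * w k
          = (w k * a - τ a * w k) + (w k * v k - τ (v k) * w k) * b
            + τ (v k) * (w k * b - τ b * w k) := by rw [map_add, map_mul]; noncomm_ring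
      rw [h1, h2, h3, h] at h4
      simpa using h4
    have h1 : Module.finrank F ((orderedSpan F v k).map (LinearMap.mulLeft F (v k))) = 2 ^ k := by
      rw [← ih (by omega), ← LinearMap.range_domRestrict]
      refine LinearMap.finrank_range_of_inj ((injective_iff_map_eq_zero _).mpr fun x hx => ?_)
      exact Subtype.ext (key 0 (zero_mem _) x x.2 (by rw [zero_add]; exact hx))
    have h2 : orderedSpan F v k ⊓ (orderedSpan F v k).map (LinearMap.mulLeft F (v k)) = ⊥ := by
      rw [eq_bot_iff]
      rintro x ⟨hx, b, hb, rfl⟩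
      have := key _ (neg_mem hx) b hb (by simp)
      simp [this]
    have h3 := Submodule.finrank_sup_add_finrank_inf_eq (orderedSpan F v k)
      ((orderedSpan F v k).map (LinearMap.mulLeft F (v k)))
    rw [h2, h1, ih (by omega), finrank_bot] at h3
    rw [orderedSpan, pow_succ]
    omega

end OrderedSpan

/-! ### Transport of quadratic pairs -/

section Transport

variable {F A B : Type*} [Field F] [Ring A] [Algebra F A] [Ring B] [Algebra F B]

/-- An isomorphism of algebras, restricted to the centres. -/
def centerEquiv (e : A ≃ₐ[F] B) : Subalgebra.center F A ≃ₗ[F] Subalgebra.center F B where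
  toFun z := ⟨e z, Subalgebra.mem_center_iff.mpr fun b => by
    obtain ⟨a, rfl⟩ := e.surjective b
    rw [← map_mul, ← map_mul, Subalgebra.mem_center_iff.mp z.2]⟩
  invFun z := ⟨e.symm z, Subalgebra.mem_center_iff.mpr fun b => by
    obtain ⟨a, rfl⟩ := e.symm.surjective b
    rw [← map_mul, ← map_mul, Subalgebra.mem_center_iff.mp z.2]⟩
  map_add' x y := Subtype.ext (map_add e _ _)
  map_smul' c x := Subtype.ext (map_smul e c _)
  left_inv z := Subtype.ext (e.symm_apply_apply _)
  right_inv z := Subtype.ext (e.apply_symm_apply _)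

@[simp] theorem coe_centerEquiv (e : A ≃ₐ[F] B) (z : Subalgebra.center F A) :
    (centerEquiv e z : B) = e z := rfl

theorem IsAbsolutelyIrreducible.comp_algEquiv {n : ℕ}
    {ρ : B →ₐ[F] Matrix (Fin n) (Fin n) (AlgebraicClosure F)} (hρ : IsAbsolutelyIrreducible ρ)
    (e : A ≃ₐ[F] B) : IsAbsolutelyIrreducible (ρ.comp (e : A →ₐ[F] B)) := by
  refine ⟨hρ.1, ?_⟩
  rw [← hρ.2, AlgHom.coe_comp]
  exact congrArg _ (e.surjective.range_comp _)

theorem IsReducedTrace.map {t : A →ₗ[F] Subalgebra.center F A} (ht : IsReducedTrace F A t)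
    (e : A ≃ₐ[F] B) : IsReducedTrace F B
      ((centerEquiv e).toLinearMap ∘ₗ t ∘ₗ e.symm.toLinearMap) := by
  intro n ρ hρ b
  have := ht n _ (hρ.comp_algEquiv e) (e.symm b)
  simpa using this

theorem HasReducedTrace.map (h : HasReducedTrace F A) (e : A ≃ₐ[F] B) : HasReducedTrace F B := by
  refine ⟨⟨_, h.isReducedTrace.map e⟩, fun b hb => ?_⟩
  rw [← map_eq_zero_iff e.symm e.symm.injective]
  refine h.faithful _ fun n ρ hρ => ?_
  exact hb n _ (hρ.comp_algEquiv e.symm)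

theorem HasReducedTrace.reducedTrace_map (h : HasReducedTrace F A) (e : A ≃ₐ[F] B) (a : A) :
    (reducedTrace F B (e a) : B) = e (reducedTrace F A a) := by
  rw [(h.map e).reducedTrace_eq (h.isReducedTrace.map e)]
  simp

theorem HasReducedTrace.reducedTrace_prod (hA : HasReducedTrace F A) (hB : HasReducedTrace F B)
    (x : A × B) : (reducedTrace F (A × B) x : A × B)
      = ((reducedTrace F A x.1 : A), (reducedTrace F B x.2 : B)) := by
  rw [(hA.prod hB).reducedTrace_eq (hA.isReducedTrace.prod hB.isReducedTrace)]
  rfl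

/-- The symmetric elements of an involution transported by an isomorphism. -/
def symElementsEquiv (e : A ≃ₐ[F] B) (σ : A →ₗ[F] A) : symElements σ ≃ₗ[F]
    symElements (e.toLinearMap ∘ₗ σ ∘ₗ e.symm.toLinearMap) where
  toFun s := ⟨e s, by
    have h : σ s = s := s.2
    simp [mem_symElements, h]⟩
  invFun s := ⟨e.symm s, by
    have h : e (σ (e.symm s)) = s := s.2
    rw [mem_symElements]
    exact e.injective (by rw [h, AlgEquiv.apply_symm_apply])⟩
  map_add' x y := Subtype.ext (map_add e _ _)
  map_smul' c x := Subtype.ext (map_smul e c _)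
  left_inv z := Subtype.ext (e.symm_apply_apply _)
  right_inv z := Subtype.ext (e.apply_symm_apply _)

namespace QuadraticPair

variable {n m : ℕ}

/-- The quadratic pair transported by an isomorphism of algebras. -/
def map (P : QuadraticPair F n A) (e : A ≃ₐ[F] B) (hn : n = m) : QuadraticPair F m B where
  finiteDimensional := by
    have := P.finiteDimensional
    exact e.toLinearEquiv.finiteDimensional
  hasReducedTrace := P.hasReducedTrace.map e
  finrank_eq := by
    rw [← e.toLinearEquiv.finrank_eq, ← (centerEquiv e).finrank_eq, P.finrank_eq, hn]
  σ := e.toLinearMap ∘ₗ P.σ ∘ₗ e.symm.toLinearMap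
  σ_mul a b := by simp [P.σ_mul]
  σ_σ a := by simp [P.σ_σ]
  σ_center z hz := by
    have := P.σ_center _ ((centerEquiv e).symm ⟨z, hz⟩).2
    change P.σ (e.symm z) = e.symm z at this
    simp [this]
  finrank_sym := by
    rw [← (symElementsEquiv e P.σ).finrank_eq, ← (centerEquiv e).finrank_eq, P.finrank_sym, hn]
  f := (centerEquiv e).toLinearMap ∘ₗ P.f ∘ₗ (symElementsEquiv e P.σ).symm.toLinearMap
  f_center z s t h := by
    have := P.f_center ((centerEquiv e).symm z) ((symElementsEquiv e P.σ).symm s)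
      ((symElementsEquiv e P.σ).symm t) (by
        change e.symm t = e.symm z * e.symm s
        rw [h, map_mul])
    apply (centerEquiv e).symm.injective
    simp only [LinearMap.comp_apply, LinearEquiv.coe_coe, LinearEquiv.symm_apply_apply, this]
    apply Subtype.ext
    change _ = e.symm (z * e (P.f _))
    rw [map_mul, AlgEquiv.symm_apply_apply]
    rfl
  f_add_σ x hx := by
    have hs : e.symm x + P.σ (e.symm x) ∈ symElements P.σ := by
      rw [mem_symElements, map_add, P.σ_σ, add_comm]
    have h : (symElementsEquiv e P.σ).symm ⟨_, hx⟩ = ⟨_, hs⟩ := by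
      apply Subtype.ext
      change e.symm (x + e (P.σ (e.symm x))) = _
      rw [map_add, AlgEquiv.symm_apply_apply]
    apply Subtype.ext
    change e (P.f ((symElementsEquiv e P.σ).symm ⟨_, hx⟩)) = _
    rw [h, P.f_add_σ, ← P.hasReducedTrace.reducedTrace_map, AlgEquiv.apply_symm_apply]

/-- The transported pair is isomorphic to the original one. -/
def mapIso (P : QuadraticPair F n A) (e : A ≃ₐ[F] B) (hn : n = m) : (P.map e hn).Iso P where
  toAlgEquiv := e.symm
  map_σ a := by simp [map]
  map_f s t h := by
    have : t = (symElementsEquiv e P.σ).symm s := Subtype.ext h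
    rw [this]
    exact (e.symm_apply_apply _).symm

end QuadraticPair

end Transport

/-! ### Relations among the values of an even Clifford map -/

section EvenHom

open CliffordAlgebra (EvenHom)

variable {F V R : Type*} [Field F] [AddCommGroup V] [Module F V] [Ring R] [Algebra F R]
  {q : QuadraticForm F V}

theorem CliffordAlgebra.EvenHom.bilin_add_swap (g : EvenHom q R) (x y : V) :
    g.bilin x y + g.bilin y x = algebraMap F R (q.polarBilin x y) := by
  have h := g.contract (x + y)
  simp only [map_add, LinearMap.add_apply, g.contract] at h
  rw [QuadraticMap.polarBilin_apply_apply, QuadraticMap.polar, map_sub, map_sub, ← h]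
  abel

/-- Swapping the arguments of the first factor brings the two copies of `e` together, where they
contract to `q e = 1`. -/
theorem CliffordAlgebra.EvenHom.bilin_mul_bilin (g : EvenHom q R) {e : V} (he : q e = 1) (x y : V) :
    g.bilin e x * g.bilin e y = q.polarBilin e x • g.bilin e y - g.bilin x y := by
  rw [eq_sub_of_add_eq (g.bilin_add_swap e x), sub_mul, g.contract_mid, he, one_smul,
    Algebra.smul_def]

/-- The elements `g.bilin e (u i)` behave like the products `e * u i` in the Clifford algebra of
`q`: each satisfies a quadratic equation, and any two anticommute up to scalars and linear terms.
These are the relations needed for straightening. -/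
theorem CliffordAlgebra.EvenHom.mul_mem_orderedSpan (g : EvenHom q R) {e : V} (he : q e = 1) (u : ℕ → V) {k i : ℕ}
    (hi : i < k) {x : R} (hx : x ∈ orderedSpan F (fun i => g.bilin e (u i)) k) :
    g.bilin e (u i) * x ∈ orderedSpan F (fun i => g.bilin e (u i)) k := by
  refine _root_.mul_mem_orderedSpan (n := k) ?_ ?_ k le_rfl i hi x hx
  · intro i _
    refine ⟨-q (u i), q.polarBilin e (u i), ?_⟩
    rw [g.bilin_mul_bilin he, g.contract, Algebra.smul_def (-q (u i)), map_neg, mul_one]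
    abel
  · intro i _ j _
    refine ⟨-q.polarBilin (u i) (u j), q.polarBilin e (u j), q.polarBilin e (u i), ?_⟩
    rw [g.bilin_mul_bilin he, g.bilin_mul_bilin he, Algebra.smul_def (-_), map_neg, mul_one,
      ← g.bilin_add_swap]
    abel

end EvenHom

/-- The terms at `(i, j)` and `(j, i)` cancel and the diagonal vanishes separately, so
characteristic 2 needs no special treatment. Both reductions of the Clifford relations to special
tensors rest on this. -/
theorem sum_smul_eq_zero_of_symm_of_alternating {F M ι : Type*} [Field F] [AddCommGroup M]
    [Module F M] [Fintype ι] (c : ι → ι → F) (g : ι → ι → M) (hc : ∀ i j, c i j = c j i)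
    (hg : ∀ i, g i i = 0) (hg' : ∀ i j, g i j + g j i = 0) :
    ∑ i, ∑ j, c i j • g i j = 0 := by
  rw [← Fintype.sum_prod_type']
  refine Finset.sum_involution (fun p _ => p.swap) ?_ ?_ (fun _ _ => Finset.mem_univ _) ?_
  · rintro ⟨i, j⟩ _
    simp only [Prod.swap_prod_mk]
    rw [hc j i, ← smul_add, hg', smul_zero]
  · rintro ⟨i, j⟩ _ h h'
    obtain rfl : j = i := congrArg Prod.fst h'
    exact h (by simp [hg])
  · rintro ⟨i, j⟩ _
    rfl

/-! ### The identification of `V ⊗ V` with `End(V)`, and special tensors that suffice -/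

section StandardEnd

variable {F V : Type*} [Field F] [AddCommGroup V] [Module F V] {q : QuadraticForm F V}

theorem standardEnd_apply (x y z : V) : standardEnd q x y z = q.polarBilin y z • x := rfl

theorem mul_standardEnd (a : Module.End F V) (x y : V) :
    a * standardEnd q x y = standardEnd q (a x) y := by
  ext z
  simp [standardEnd_apply]

theorem standardEnd_mul_standardEnd (x y z w : V) :
    standardEnd q x y * standardEnd q z w = q.polarBilin y z • standardEnd q x w := by
  ext t
  simp only [Module.End.mul_apply, standardEnd_apply, map_smul, LinearMap.smul_apply, smul_smul,
    mul_comm]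

theorem trace_standardEnd [FiniteDimensional F V] (x y : V) :
    LinearMap.trace F V (standardEnd q x y) = q.polarBilin y x := by
  rw [standardEnd, LinearMap.trace_smulRight]

theorem sand_standardEnd (x y z w : V) (a : Module.End F V) :
    QuadraticPair.sand F _ (standardEnd q x y ⊗ₜ standardEnd q z w) a
      = q.polarBilin y (a z) • standardEnd q x w := by
  rw [QuadraticPair.sand_tmul, mul_assoc, mul_standardEnd, standardEnd_mul_standardEnd]

namespace IsNonsingularForm

variable (hq : IsNonsingularForm q)

theorem adjoint_standardEnd (x y : V) :
    hq.adjointInvolution (standardEnd q x y) = standardEnd q y x := by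
  ext z
  refine hq.ext_left fun w => ?_
  rw [polarBilin_adjoint_left, standardEnd_apply, standardEnd_apply, map_smul, map_smul,
    LinearMap.smul_apply, smul_eq_mul, smul_eq_mul, polarBilin_symm q z x, mul_comm]

/-- The isomorphism `V ⊗ V ≃ End_F(V)` given on pure tensors by `standardEnd`. -/
def standardEquiv : V ⊗[F] V ≃ₗ[F] Module.End F V :=
  haveI := hq.finiteDimensional
  TensorProduct.comm F V V ≪≫ₗ TensorProduct.congr hq.polarDual (LinearEquiv.refl F V) ≪≫ₗ
    dualTensorHomEquiv F V V

@[simp] theorem standardEquiv_tmul (x y : V) :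
    hq.standardEquiv (x ⊗ₜ y) = standardEnd q x y := by
  ext z
  simp [standardEquiv, standardEnd_apply, polarDual_apply]

theorem exists_dual {q : QuadraticForm F V} (hq : IsNonsingularForm q) {ι : Type*} [Fintype ι] [DecidableEq ι] (e : Module.Basis ι F V) :
    ∃ e' : ι → V, (∀ i j, q.polarBilin (e' i) (e j) = if i = j then 1 else 0) ∧
      (∀ x, ∑ i, q.polarBilin (e' i) x • e i = x) ∧
      (∀ x, ∑ i, q.polarBilin (e i) x • e' i = x) := by
  let e' := LinearMap.BilinForm.dualBasis q.polarBilin hq.nondegenerate e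
  have h1 : ∀ i j, q.polarBilin (e' i) (e j) = if i = j then 1 else 0 := fun i j => by
    rw [LinearMap.BilinForm.apply_dualBasis_left]
    simp [eq_comm]
  have h2 : ∀ x, ∑ i, q.polarBilin (e' i) x • e i = x := by
    intro x
    conv_rhs => rw [← e.sum_repr x]
    refine Finset.sum_congr rfl fun i _ => congrArg (· • e i) ?_
    conv_lhs => rw [← e.sum_repr x]
    simp only [map_sum, map_smul, h1, smul_eq_mul, mul_ite, mul_one, mul_zero,
      Finset.sum_ite_eq, Finset.mem_univ, if_true]
  refine ⟨e', h1, h2, fun x => ?_⟩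
  refine hq.ext_left fun z => ?_
  conv_rhs => rw [← h2 z]
  simp only [map_sum, map_smul, LinearMap.sum_apply, LinearMap.smul_apply, smul_eq_mul]
  exact Finset.sum_congr rfl fun i _ => by rw [mul_comm, polarBilin_symm q x]

/-- Matrix coefficients are read off with the dual vectors on both sides, so a self-adjoint `a` has
a symmetric coefficient matrix. -/
theorem sum_smul_standardEnd {ι : Type*} [Fintype ι] {e e' : ι → V}
    (h1 : ∀ x, ∑ i, q.polarBilin (e' i) x • e i = x)
    (h2 : ∀ x, ∑ i, q.polarBilin (e i) x • e' i = x) (a : Module.End F V) :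
    ∑ i, ∑ j, q.polarBilin (e' i) (a (e' j)) • standardEnd q (e i) (e j) = a := by
  ext z
  simp only [LinearMap.sum_apply, LinearMap.smul_apply, standardEnd_apply]
  rw [Finset.sum_comm]
  simp only [smul_comm _ (q.polarBilin (e _) z), ← Finset.smul_sum, h1]
  simp only [← map_smul, ← map_sum, h2]

/-- A linear map on `End_F(V)` that vanishes on the squares `standardEnd q x x` vanishes on the
symmetric elements. -/
theorem eq_zero_of_symElements {q : QuadraticForm F V} (hq : IsNonsingularForm q)
    {M : Type*} [AddCommGroup M] [Module F M]
    (L : Module.End F V →ₗ[F] M) (hL : ∀ x, L (standardEnd q x x) = 0) {s : Module.End F V}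
    (hs : hq.adjointInvolution s = s) : L s = 0 := by
  have := hq.finiteDimensional
  obtain ⟨e', -, h1, h2⟩ := hq.exists_dual (Module.finBasis F V)
  rw [← sum_smul_standardEnd h1 h2 s]
  simp only [map_sum, map_smul]
  -- The coefficients are symmetric because `s` is self-adjoint; polarizing the hypothesis on
  -- squares makes `L` alternating on the pairs of basis vectors.
  refine sum_smul_eq_zero_of_symm_of_alternating _ _ (fun i j => ?_) (fun i => hL _) fun i j => ?_
  · rw [← hq.polarBilin_adjoint_left, hs, polarBilin_symm]
  · have := hL (Module.finBasis F V i + Module.finBasis F V j)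
    have h3 : ∀ x y : V, standardEnd q (x + y) (x + y) = standardEnd q x x + standardEnd q y y
        + (standardEnd q x y + standardEnd q y x) := by
      intro x y
      simp only [← hq.standardEquiv_tmul, TensorProduct.tmul_add, TensorProduct.add_tmul, map_add]
      abel
    rwa [h3, map_add, map_add, hL, hL, zero_add, zero_add, map_add] at this

/-- Coefficients of `u` are recovered from `Sand u` alone, by evaluating it on products of dual
vectors; this makes `σ₂`-invariance, a condition on `Sand u`, visible in them. The sum over the two
middle indices `j`, `k` is innermost because the invariance concerns just these. -/
theorem sum_smul_tmul_standardEnd {ι : Type*} [Fintype ι] {e e' : ι → V}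
    (h1 : ∀ x, ∑ i, q.polarBilin (e' i) x • e i = x)
    (h2 : ∀ x, ∑ i, q.polarBilin (e i) x • e' i = x)
    (u : Module.End F V ⊗[F] Module.End F V) :
    ∑ i, ∑ l, ∑ j, ∑ k, q.polarBilin (e' i)
      (QuadraticPair.sand F _ u (standardEnd q (e' j) (e' k)) (e' l)) •
        (standardEnd q (e i) (e j) ⊗ₜ[F] standardEnd q (e k) (e l)) = u := by
  induction u using TensorProduct.induction_on with
  | zero => simp
  | add u v hu hv =>
    conv_rhs => rw [← hu, ← hv]
    simp only [map_add, LinearMap.add_apply, add_smul, Finset.sum_add_distrib]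
  | tmul a b =>
    conv_rhs => rw [← sum_smul_standardEnd h1 h2 a, ← sum_smul_standardEnd h1 h2 b]
    simp only [TensorProduct.sum_tmul]
    simp only [TensorProduct.tmul_sum, TensorProduct.smul_tmul_smul]
    refine Finset.sum_congr rfl fun i _ => ?_
    rw [Finset.sum_comm]
    refine Finset.sum_congr rfl fun j _ => ?_
    rw [Finset.sum_comm]
    refine Finset.sum_congr rfl fun k _ => Finset.sum_congr rfl fun l _ => ?_
    simp [standardEnd_apply, mul_comm]

/-- A linear map on `End_F(V) ⊗ End_F(V)` that vanishes on the tensors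
`standardEnd q x y ⊗ standardEnd q y w` vanishes on the `σ₂`-invariant elements. -/
theorem eq_zero_of_isSigmaTwoInvariant {q : QuadraticForm F V} (hq : IsNonsingularForm q)
    {M : Type*} [AddCommGroup M] [Module F M]
    (L : Module.End F V ⊗[F] Module.End F V →ₗ[F] M)
    (hL : ∀ x y w, L (standardEnd q x y ⊗ₜ standardEnd q y w) = 0)
    {u : Module.End F V ⊗[F] Module.End F V} (hu : hq.Ad.IsSigmaTwoInvariant u) : L u = 0 := by
  have := hq.finiteDimensional
  obtain ⟨e', -, h1, h2⟩ := hq.exists_dual (Module.finBasis F V)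
  rw [← sum_smul_tmul_standardEnd h1 h2 u]
  simp only [map_sum, map_smul]
  refine Finset.sum_eq_zero fun i _ => Finset.sum_eq_zero fun l _ => ?_
  -- The involution exchanges `standardEnd q (e' j) (e' k)` and `standardEnd q (e' k) (e' j)`, so
  -- `σ₂`-invariance is symmetry of the coefficients in `j` and `k`. Polarization in the middle
  -- vector gives the alternating condition.
  refine sum_smul_eq_zero_of_symm_of_alternating _ _ (fun j k => ?_) (fun i => hL _ _ _)
    fun j k => ?_
  · have := hu (standardEnd q (e' k) (e' j))
    change QuadraticPair.sand F _ u (hq.adjointInvolution _) = _ at this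
    rw [adjoint_standardEnd] at this
    rw [this]
  · have := hL (Module.finBasis F V i) (Module.finBasis F V j + Module.finBasis F V k)
      (Module.finBasis F V l)
    have h3 : ∀ x y z : V, standardEnd q x (y + z) = standardEnd q x y + standardEnd q x z := by
      intro x y z
      simp only [← hq.standardEquiv_tmul, TensorProduct.tmul_add, map_add]
    have h4 : ∀ x y z : V, standardEnd q (x + y) z = standardEnd q x z + standardEnd q y z := by
      intro x y z
      simp only [← hq.standardEquiv_tmul, TensorProduct.add_tmul, map_add]
    rwa [h3, h4, TensorProduct.add_tmul, TensorProduct.tmul_add, TensorProduct.tmul_add, map_add,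
      map_add, map_add, hL, hL, zero_add, add_zero] at this

end IsNonsingularForm

end StandardEnd

/-! ### The Clifford algebra of the adjoint quadratic pair -/

section CliffordAd

open CliffordAlgebra (EvenHom)

namespace IsNonsingularForm

variable {F V R : Type*} [Field F] [AddCommGroup V] [Module F V] [Ring R] [Algebra F R]
  {q : QuadraticForm F V} (hq : IsNonsingularForm q)

/-- The linear map `End_F(V) → R` with `standardEnd q x y ↦ g x y`. -/
def evenMap (g : EvenHom q R) : Module.End F V →ₗ[F] R :=
  TensorProduct.lift g.bilin ∘ₗ hq.standardEquiv.symm.toLinearMap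

@[simp] theorem evenMap_standardEnd (g : EvenHom q R) (x y : V) :
    hq.evenMap g (standardEnd q x y) = g.bilin x y := by
  rw [← hq.standardEquiv_tmul, evenMap, LinearMap.comp_apply, LinearEquiv.coe_coe,
    LinearEquiv.symm_apply_apply, TensorProduct.lift.tmul]

theorem algebraMap_end_injective [Nontrivial V] :
    Function.Injective (algebraMap F (Module.End F V)) :=
  FaithfulSMul.algebraMap_injective F _

/-- Evaluate `f s = Trd (ℓ s)` on the tensor `y ⊗ y`. Only this value of `ℓ` enters the sandwich
relation for `x ⊗ y ⊗ y ⊗ w`, which is why the choice of `ℓ` is immaterial. -/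
theorem polarBilin_of_determines [Nontrivial V] {ℓ : Module.End F V} (hℓ : hq.Ad.Determines ℓ)
    (y : V) : q.polarBilin y (ℓ y) = q y := by
  have := hq.finiteDimensional
  have h := congrArg Subtype.val (hℓ.2 ⟨_, hq.standardEnd_mem_symElements y⟩)
  rw [hq.Ad_f_standardEnd, coe_reducedTrace_end, mul_standardEnd, trace_standardEnd] at h
  exact (algebraMap_end_injective h).symm

theorem determines_ell : hq.Ad.Determines hq.ell := by
  have := hq.finiteDimensional
  refine ⟨hq.ell_add_adjoint, fun s => Subtype.ext ?_⟩
  rw [coe_reducedTrace_end]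
  rfl

/-- Each relation is linear in `s` or `u`, so it need only be checked on the tensors `x ⊗ x` and `x
⊗ y ⊗ y ⊗ w`. There it is one of the two axioms of an even Clifford map. -/
theorem lift_cliffordRel [Nontrivial V] (g : EvenHom q R) {x y : TensorAlgebra F (Module.End F V)}
    (h : hq.Ad.CliffordRel x y) :
    TensorAlgebra.lift F (hq.evenMap g) x = TensorAlgebra.lift F (hq.evenMap g) y := by
  have := hq.finiteDimensional
  cases h with
  | sym s r h =>
    rw [TensorAlgebra.lift_ι_apply, AlgHom.commutes]
    have hr : r = LinearMap.trace F V (hq.ell * s) := (algebraMap_end_injective h).symm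
    have := hq.eq_zero_of_symElements (hq.evenMap g - (Algebra.linearMap F R ∘ₗ
      LinearMap.trace F V ∘ₗ LinearMap.mulLeft F hq.ell)) (fun x => by
        simp only [LinearMap.sub_apply, evenMap_standardEnd, g.contract, LinearMap.comp_apply,
          LinearMap.mulLeft_apply, mul_standardEnd, trace_standardEnd,
          hq.polarBilin_of_determines hq.determines_ell, Algebra.linearMap_apply, sub_self]) s.2
    rw [hr]
    exact sub_eq_zero.mp this
  | sandwich u hu ℓ hℓ =>
    rw [TensorAlgebra.lift_ι_apply]
    have := hq.eq_zero_of_isSigmaTwoInvariant ((TensorAlgebra.lift F (hq.evenMap g)).toLinearMap ∘ₗ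
      QuadraticPair.tensorSquare F (Module.End F V) -
        hq.evenMap g ∘ₗ (QuadraticPair.sand F (Module.End F V)).flip ℓ) (fun x y w => by
          simp only [LinearMap.sub_apply, LinearMap.comp_apply,
            QuadraticPair.tensorSquare_tmul, AlgHom.toLinearMap_apply, map_mul,
            TensorAlgebra.lift_ι_apply, evenMap_standardEnd, g.contract_mid,
            LinearMap.flip_apply, sand_standardEnd, map_smul,
            hq.polarBilin_of_determines hℓ, sub_self]) hu
    exact sub_eq_zero.mp this

/-- The homomorphism from the Clifford algebra of `Ad_q` induced by an even Clifford map. -/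
def cliffordLift [Nontrivial V] (g : EvenHom q R) : hq.Ad.Clifford →ₐ[F] R :=
  (RingQuot.liftAlgHom F ⟨TensorAlgebra.lift F (hq.evenMap g), fun _ _ h =>
    hq.lift_cliffordRel g h⟩ : RingQuot hq.Ad.CliffordRel →ₐ[F] R)

theorem cliffordLift_c [Nontrivial V] (g : EvenHom q R) (a : Module.End F V) :
    hq.cliffordLift g (hq.Ad.c a) = hq.evenMap g a := by
  change RingQuot.liftAlgHom F _ (RingQuot.mkAlgHom F hq.Ad.CliffordRel _) = _
  rw [RingQuot.liftAlgHom_mkAlgHom_apply, TensorAlgebra.lift_ι_apply]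

/-- The canonical even Clifford map `(x, y) ↦ c (standardEnd q x y)`. -/
def cliffordEvenHom : EvenHom q hq.Ad.Clifford where
  bilin := (TensorProduct.mk F V V).compr₂ (hq.Ad.c ∘ₗ hq.standardEquiv.toLinearMap)
  contract x := by
    change hq.Ad.c (hq.standardEquiv (x ⊗ₜ x)) = _
    rw [standardEquiv_tmul]
    exact hq.Ad.c_sym ⟨_, hq.standardEnd_mem_symElements x⟩ _ (hq.Ad_f_standardEnd x _)
  contract_mid x y w := by
    change hq.Ad.c (hq.standardEquiv (x ⊗ₜ y)) * hq.Ad.c (hq.standardEquiv (y ⊗ₜ w))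
      = q y • hq.Ad.c (hq.standardEquiv (x ⊗ₜ w))
    simp only [standardEquiv_tmul]
    -- This tensor is `σ₂`-invariant because `b_q(y, σ(a) y) = b_q(y, a y)`; its sandwich at `ell`
    -- is `q y` times `standardEnd q x w`.
    have h := hq.Ad.toClifford_tensorSquare (standardEnd q x y ⊗ₜ standardEnd q y w)
      (fun a => by
        rw [sand_standardEnd, sand_standardEnd]
        change q.polarBilin y (hq.adjointInvolution a y) • _ = _
        rw [polarBilin_adjoint_right, polarBilin_symm]) hq.ell hq.determines_ell
    rw [sand_standardEnd, polarBilin_symm, polarBilin_ell, bilinOf_self, map_smul,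
      QuadraticPair.tensorSquare_tmul, map_mul] at h
    exact h

theorem cliffordEvenHom_bilin (x y : V) :
    hq.cliffordEvenHom.bilin x y = hq.Ad.c (standardEnd q x y) := by
  rw [← standardEquiv_tmul]
  rfl

/-- The Clifford algebra is spanned by ordered products of even generators. -/
theorem orderedSpan_cliffordEvenHom {n : ℕ} (e : Module.Basis (Fin (n + 1)) F V)
    (he : q (e 0) = 1) :
    orderedSpan F (fun i => hq.cliffordEvenHom.bilin (e 0) (e (Fin.ofNat (n + 1) (i + 1)))) n
      = ⊤ := by
  set g := hq.cliffordEvenHom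
  set S := orderedSpan F (fun i => g.bilin (e 0) (e (Fin.ofNat (n + 1) (i + 1)))) n
  -- The span is shown to be a left ideal containing `1`. The generator of index `i` uses the basis
  -- vector `i + 1`, since `e 0` itself contributes only the scalar `q (e 0) = 1`; the reduction
  -- modulo `n + 1` in `Fin.ofNat` has no effect for `i < n`.
  have h1 : ∀ x : V, ∀ s ∈ S, g.bilin (e 0) x * s ∈ S := by
    intro x s hs
    rw [← e.sum_repr x, map_sum, Finset.sum_mul]
    refine Submodule.sum_mem _ fun i _ => ?_
    rw [map_smul, smul_mul_assoc]
    refine Submodule.smul_mem _ _ ?_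
    refine Fin.cases ?_ (fun i => ?_) i
    · rw [g.contract, he, map_one, one_mul]
      exact hs
    · have := g.mul_mem_orderedSpan he (fun i => e (Fin.ofNat (n + 1) (i + 1))) i.2 hs
      have hi : Fin.ofNat (n + 1) (i + 1) = i.succ := by
        ext
        simp
      rwa [hi] at this
  have h2 : ∀ x : V, ∀ s ∈ S, g.bilin x (e 0) * s ∈ S := by
    intro x s hs
    rw [eq_sub_of_add_eq (g.bilin_add_swap x (e 0)), sub_mul, ← Algebra.smul_def]
    exact sub_mem (Submodule.smul_mem _ _ hs) (h1 x s hs)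
  have h3 : ∀ a, ∀ s ∈ S, hq.Ad.c a * s ∈ S := by
    intro a s hs
    obtain ⟨t, rfl⟩ := hq.standardEquiv.surjective a
    induction t using TensorProduct.induction_on with
    | zero => simp
    | tmul x y =>
      -- Since `q (e 0) = 1`, every `c (x ⊗ y)` factors through `e 0` as `g.bilin x (e 0) * g.bilin
      -- (e 0) y`.
      have := g.contract_mid x (e 0) y
      rw [he, one_smul] at this
      rw [standardEquiv_tmul, ← cliffordEvenHom_bilin, ← this, mul_assoc]
      exact h2 _ _ (h1 _ _ hs)
    | add t t' ht ht' =>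
      rw [map_add, map_add, add_mul]
      exact add_mem ht ht'
  have h4 : ∀ t, ∀ s ∈ S, hq.Ad.toClifford t * s ∈ S := by
    intro t
    induction t using TensorAlgebra.induction with
    | algebraMap r =>
      intro s hs
      rw [AlgHom.commutes, ← Algebra.smul_def]
      exact Submodule.smul_mem _ _ hs
    | ι a => exact h3 a
    | mul t t' ht ht' =>
      intro s hs
      rw [map_mul, mul_assoc]
      exact ht _ (ht' _ hs)
    | add t t' ht ht' =>
      intro s hs
      rw [map_add, add_mul]
      exact add_mem (ht _ hs) (ht' _ hs)
  rw [eq_top_iff]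
  intro z _
  obtain ⟨t, rfl⟩ := RingQuot.mkAlgHom_surjective F hq.Ad.CliffordRel z
  have := h4 t 1 (one_mem_orderedSpan _ _)
  rwa [mul_one] at this

/-- An even Clifford map induces an isomorphism from the Clifford algebra of `Ad_q` if its target
has the dimension `2 ^ n` of the even Clifford algebra, and if there is an automorphism that acts
as conjugation by a vector `e 0` with `q (e 0) = 1`. -/
theorem bijective_cliffordLift [Nontrivial V] [Nontrivial R] [FiniteDimensional F R] {n : ℕ}
    (e : Module.Basis (Fin (n + 1)) F V) (he : q (e 0) = 1) (g : EvenHom q R) (τ : R →ₐ[F] R)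
    (hτ : ∀ x, τ (g.bilin (e 0) x) = g.bilin x (e 0)) (hR : Module.finrank F R = 2 ^ n) :
    Function.Bijective (hq.cliffordLift g) := by
  have := hq.finiteDimensional
  obtain ⟨e', h1, -, -⟩ := hq.exists_dual e
  set u : ℕ → V := fun i => e (Fin.ofNat (n + 1) (i + 1)) with hu
  have hC := hq.orderedSpan_cliffordEvenHom e he
  have hRS : Module.finrank F (orderedSpan F (fun i => g.bilin (e 0) (u i)) n) = 2 ^ n := by
    -- The `w i` come from the dual basis. As `b_q(e 0, e' (i+1)) = 0`, the twisted derivation of `w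
    -- i` on the `j`-th generator is `-(g.bilin (e' (i+1)) (u j) + g.bilin (u j) (e' (i+1)))`, which
    -- is minus the Kronecker delta.
    refine finrank_orderedSpan (w := fun i => g.bilin (e 0) (e' (Fin.ofNat (n + 1) (i + 1)))) τ
      (fun i hi j hj => ?_) n le_rfl
    have hi' : Fin.ofNat (n + 1) (i + 1) ≠ 0 := by
      rw [Ne, Fin.ext_iff]
      simp [Nat.mod_eq_of_lt (Nat.succ_lt_succ hi)]
    have hij : Fin.ofNat (n + 1) (i + 1) = Fin.ofNat (n + 1) (j + 1) ↔ i = j := by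
      rw [Fin.ext_iff]
      simp [Nat.mod_eq_of_lt (Nat.succ_lt_succ hi), Nat.mod_eq_of_lt (Nat.succ_lt_succ hj)]
    rw [g.bilin_mul_bilin he, hτ, g.contract_mid, he, one_smul, polarBilin_symm, h1, if_neg hi',
      zero_smul, zero_sub, ← neg_add', g.bilin_add_swap, h1]
    simp only [hij]
    split_ifs <;> simp
  have hmap : (orderedSpan F (fun i => hq.cliffordEvenHom.bilin (e 0) (u i)) n).map
      (hq.cliffordLift g).toLinearMap = orderedSpan F (fun i => g.bilin (e 0) (u i)) n := by
    rw [map_orderedSpan]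
    congr 1
    funext i
    rw [cliffordEvenHom_bilin, cliffordLift_c, evenMap_standardEnd]
  have hfin : FiniteDimensional F hq.Ad.Clifford := by
    have : FiniteDimensional F (⊤ : Submodule F hq.Ad.Clifford) := by
      rw [← hC]
      infer_instance
    exact Module.Finite.equiv Submodule.topEquiv
  have hdim : Module.finrank F hq.Ad.Clifford ≤ 2 ^ n := by
    rw [← finrank_top, ← hC]
    exact finrank_orderedSpan_le _ _
  -- The image already has the full dimension `2 ^ n` of the target, while the source has dimension
  -- at most `2 ^ n`; so surjectivity gives bijectivity.
  have hsurj : Function.Surjective (hq.cliffordLift g).toLinearMap := by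
    rw [← LinearMap.range_eq_top, LinearMap.range_eq_map, ← hC, hmap]
    exact Submodule.eq_top_of_finrank_eq (by rw [hRS, hR])
  have hle := LinearMap.finrank_le_finrank_of_surjective hsurj
  exact ⟨(LinearMap.injective_iff_surjective_of_finrank_eq_finrank (by omega)).mpr hsurj, hsurj⟩

end IsNonsingularForm

end CliffordAd

/-! ### Symmetric compositions -/

/-- A symmetric composition for a quadratic form `q`: a bilinear product with
`(x * y) * x = q x • y = x * (y * x)` for which the polar form of `q` is associative. -/
structure SymmetricComposition {F V : Type*} [Field F] [AddCommGroup V] [Module F V]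
    (q : QuadraticForm F V) where
  mul : V →ₗ[F] V →ₗ[F] V
  mul_mul_self : ∀ x y, mul (mul x y) x = q x • y
  self_mul_mul : ∀ x y, mul x (mul y x) = q x • y
  polarBilin_mul : ∀ x y z, q.polarBilin (mul x y) z = q.polarBilin x (mul y z)

namespace SymmetricComposition

open CliffordAlgebra (EvenHom)

variable {F V : Type*} [Field F] [AddCommGroup V] [Module F V] {q : QuadraticForm F V}
  (m : SymmetricComposition q)

/-- Left multiplication. -/
def left : V →ₗ[F] Module.End F V := m.mul

/-- Right multiplication. -/
def right : V →ₗ[F] Module.End F V := m.mul.flip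

theorem left_apply (x y : V) : m.left x y = m.mul x y := rfl

theorem right_apply (x y : V) : m.right x y = m.mul y x := rfl

theorem left_mul_right (x : V) : m.left x * m.right x = algebraMap F _ (q x) :=
  LinearMap.ext fun y => m.self_mul_mul x y

theorem right_mul_left (x : V) : m.right x * m.left x = algebraMap F _ (q x) :=
  LinearMap.ext fun y => m.mul_mul_self x y

/-- The even Clifford map given by the products of left and right multiplications. -/
def evenHom : EvenHom q (Module.End F V × Module.End F V) where
  bilin := LinearMap.mk₂ F (fun x y => (m.left x * m.right y, m.right x * m.left y))
    (fun x x' y => by simp [add_mul]) (fun c x y => by simp)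
    (fun x y y' => by simp [mul_add]) (fun c x y => by simp)
  contract x := Prod.ext (m.left_mul_right x) (m.right_mul_left x)
  contract_mid x y z := by
    refine Prod.ext ?_ ?_
    · change m.left x * m.right y * (m.left y * m.right z) = q y • (m.left x * m.right z)
      rw [mul_assoc, ← mul_assoc (m.right y), right_mul_left, ← Algebra.smul_def, mul_smul_comm]
    · change m.right x * m.left y * (m.right y * m.left z) = q y • (m.right x * m.left z)
      rw [mul_assoc, ← mul_assoc (m.left y), left_mul_right, ← Algebra.smul_def, mul_smul_comm]

theorem evenHom_bilin (x y : V) :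
    m.evenHom.bilin x y = (m.left x * m.right y, m.right x * m.left y) := rfl

/-- Conjugation by the vector `e` on the even part. -/
def twist {e : V} (he : q e = 1) :
    (Module.End F V × Module.End F V) →ₐ[F] (Module.End F V × Module.End F V) :=
  AlgHom.ofLinearMap
    -- In block matrices, `x` acts on `V × V` with off-diagonal entries `left x`, `right x` and
    -- square `q x`. As `q e = 1`, the matrix of `e` is its own inverse, and conjugating a diagonal
    -- matrix by it swaps the two entries as written here.
    ((LinearMap.mulLeft F (m.left e) ∘ₗ LinearMap.mulRight F (m.right e) ∘ₗ
        LinearMap.snd F _ _).prod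
      (LinearMap.mulLeft F (m.right e) ∘ₗ LinearMap.mulRight F (m.left e) ∘ₗ
        LinearMap.fst F _ _))
    (Prod.ext (by simp [left_mul_right, he]) (by simp [right_mul_left, he]))
    (fun a b => by
      have h1 : m.left e * m.right e = 1 := by rw [left_mul_right, he, map_one]
      have h2 : m.right e * m.left e = 1 := by rw [right_mul_left, he, map_one]
      refine Prod.ext ?_ ?_
      · change m.left e * (a.2 * b.2 * m.right e)
          = m.left e * (a.2 * m.right e) * (m.left e * (b.2 * m.right e))
        calc _ = m.left e * a.2 * 1 * b.2 * m.right e := by simp only [mul_one, mul_assoc]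
          _ = _ := by rw [← h2]; simp only [mul_assoc]
      · change m.right e * (a.1 * b.1 * m.left e)
          = m.right e * (a.1 * m.left e) * (m.right e * (b.1 * m.left e))
        calc _ = m.right e * a.1 * 1 * b.1 * m.left e := by simp only [mul_one, mul_assoc]
          _ = _ := by rw [← h1]; simp only [mul_assoc])

theorem twist_evenHom {e : V} (he : q e = 1) (x : V) :
    m.twist he (m.evenHom.bilin e x) = m.evenHom.bilin x e := by
  refine Prod.ext ?_ ?_
  · change m.left e * (m.right e * m.left x * m.right e) = m.left x * m.right e
    rw [← mul_assoc, ← mul_assoc, left_mul_right, he, map_one, one_mul]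
  · change m.right e * (m.left e * m.right x * m.left e) = m.right x * m.left e
    rw [← mul_assoc, ← mul_assoc, right_mul_left, he, map_one, one_mul]

variable (hq : IsNonsingularForm q)

/-- This is associativity of the polar form, read as `b(y * x, z) = b(y, x * z)`. -/
theorem adjoint_left (x : V) : hq.adjointInvolution (m.left x) = m.right x := by
  ext y
  refine hq.ext_left fun z => ?_
  rw [hq.polarBilin_adjoint_left]
  exact (m.polarBilin_mul y x z).symm

theorem adjoint_right (x : V) : hq.adjointInvolution (m.right x) = m.left x := by
  rw [← m.adjoint_left hq, hq.adjoint_adjoint]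

/-- Taking adjoints turns `l_x r_y` into `l_y r_x` and `r_x l_y` into `r_y l_x`, just as the adjoint
of `standardEnd q x y` is `standardEnd q y x`. -/
theorem evenMap_adjoint (a : Module.End F V) :
    hq.evenMap m.evenHom (hq.adjointInvolution a)
      = hq.adjointInvolution.prodMap hq.adjointInvolution (hq.evenMap m.evenHom a) := by
  obtain ⟨t, rfl⟩ := hq.standardEquiv.surjective a
  induction t using TensorProduct.induction_on with
  | zero => simp only [map_zero]
  | tmul x y =>
    rw [hq.standardEquiv_tmul, hq.adjoint_standardEnd, hq.evenMap_standardEnd,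
      hq.evenMap_standardEnd, evenHom_bilin, evenHom_bilin]
    simp [hq.adjoint_mul, m.adjoint_left hq, m.adjoint_right hq]
  | add s t hs ht => simp only [map_add, hs, ht]

/-- Both sides reverse products, so the generators `c a` decide. -/
theorem cliffordLift_canonicalInvolution [Nontrivial V] (z : hq.Ad.Clifford) :
    hq.cliffordLift m.evenHom (hq.Ad.canonicalInvolution z)
      = (hq.Ad.prod hq.Ad).σ (hq.cliffordLift m.evenHom z) := by
  obtain ⟨t, rfl⟩ := RingQuot.mkAlgHom_surjective F hq.Ad.CliffordRel z
  change hq.cliffordLift _ (hq.Ad.canonicalInvolution (hq.Ad.toClifford t))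
    = (hq.Ad.prod hq.Ad).σ (hq.cliffordLift _ (hq.Ad.toClifford t))
  induction t using TensorAlgebra.induction with
  | algebraMap r =>
    rw [QuadraticPair.canonicalInvolution_toClifford, AlgHom.commutes, AlgHom.commutes,
      MulOpposite.algebraMap_apply, MulOpposite.unop_op, AlgHom.commutes,
      Algebra.algebraMap_eq_smul_one, map_smul, QuadraticPair.σ_one]
  | ι a =>
    change hq.cliffordLift _ (hq.Ad.canonicalInvolution (hq.Ad.c a))
      = (hq.Ad.prod hq.Ad).σ (hq.cliffordLift _ (hq.Ad.c a))
    rw [QuadraticPair.canonicalInvolution_c, hq.cliffordLift_c, hq.cliffordLift_c]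
    exact m.evenMap_adjoint hq a
  | mul s t hs ht =>
    rw [map_mul, QuadraticPair.canonicalInvolution_mul, map_mul, map_mul, hs, ht,
      QuadraticPair.σ_mul]
  | add s t hs ht => simp only [map_add, hs, ht]

/-- For `a = standardEnd q x y`, associativity gives `b(z, x * (z * y)) = b((z * x) * z, y) = q(z)
b(x, y)`, and `b(x, y)` is the trace of `a`. The second component is symmetric. So only the trace of
`a` matters, which makes the semi-trace independent of `λ`. -/
theorem polarBilin_evenMap (a : Module.End F V) (z : V) :
    q.polarBilin z ((hq.evenMap m.evenHom a).1 z) = LinearMap.trace F V a * q z ∧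
    q.polarBilin z ((hq.evenMap m.evenHom a).2 z) = LinearMap.trace F V a * q z := by
  have := hq.finiteDimensional
  obtain ⟨t, rfl⟩ := hq.standardEquiv.surjective a
  induction t using TensorProduct.induction_on with
  | zero => simp
  | tmul x y =>
    rw [hq.standardEquiv_tmul, hq.evenMap_standardEnd, trace_standardEnd, evenHom_bilin]
    simp only [Module.End.mul_apply, left_apply, right_apply]
    constructor
    · rw [← m.polarBilin_mul, ← m.polarBilin_mul, m.mul_mul_self, map_smul, LinearMap.smul_apply,
        smul_eq_mul, polarBilin_symm, mul_comm]
    · rw [polarBilin_symm, m.polarBilin_mul, m.polarBilin_mul, m.self_mul_mul, map_smul,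
        smul_eq_mul, mul_comm]
  | add s t hs ht =>
    simp only [map_add, Prod.fst_add, Prod.snd_add, LinearMap.add_apply, add_mul, hs, ht,
      and_self]

/-- It suffices to take `s = standardEnd q z z`. Then `tr(d s) = b(z, d z)`, which the previous
lemma computes, while `tr(ell s) = q z`. -/
theorem trace_evenMap_mul (a : Module.End F V) {s : Module.End F V}
    (hs : hq.adjointInvolution s = s) :
    LinearMap.trace F V ((hq.evenMap m.evenHom a).1 * s)
        = LinearMap.trace F V a * LinearMap.trace F V (hq.ell * s) ∧
    LinearMap.trace F V ((hq.evenMap m.evenHom a).2 * s)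
        = LinearMap.trace F V a * LinearMap.trace F V (hq.ell * s) := by
  have := hq.finiteDimensional
  have key : ∀ d : Module.End F V,
      (∀ z, q.polarBilin z (d z) = LinearMap.trace F V a * q z) →
      LinearMap.trace F V (d * s)
        = LinearMap.trace F V a * LinearMap.trace F V (hq.ell * s) := by
    intro d hd
    refine sub_eq_zero.mp (hq.eq_zero_of_symElements (LinearMap.trace F V ∘ₗ LinearMap.mulLeft F d
      - LinearMap.trace F V a • (LinearMap.trace F V ∘ₗ LinearMap.mulLeft F hq.ell))
      (fun z => ?_) hs)
    simp only [LinearMap.sub_apply, LinearMap.smul_apply, LinearMap.comp_apply,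
      LinearMap.mulLeft_apply, mul_standardEnd, trace_standardEnd, hd, smul_eq_mul]
    rw [polarBilin_symm q z (hq.ell z), hq.polarBilin_ell, bilinOf_self, sub_self]
  exact ⟨key _ fun z => (m.polarBilin_evenMap hq a z).1,
    key _ fun z => (m.polarBilin_evenMap hq a z).2⟩

/-- Triality: the canonical quadratic pair on the Clifford algebra of a form of dimension eight
that admits a symmetric composition. -/
theorem exists_isCanonical_iso {q : QuadraticForm F V} (m : SymmetricComposition q)
    (hq : IsNonsingularForm q) (e : Module.Basis (Fin 8) F V) (he : q (e 0) = 1) :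
    ∃ R : QuadraticPair F 8 hq.Ad.Clifford,
      hq.Ad.IsCanonical R ∧ Nonempty (R.Iso (hq.Ad.prod hq.Ad)) := by
  have := hq.finiteDimensional
  have hn : Module.finrank F V = 8 := by simp [Module.finrank_eq_card_basis e]
  have : Nontrivial V := Module.nontrivial_of_finrank_pos (R := F) (by omega)
  have hE : Module.finrank F (Module.End F V × Module.End F V) = 2 ^ 7 := by
    rw [Module.finrank_prod, Module.finrank_linearMap, hn]
    norm_num
  let Φ : hq.Ad.Clifford ≃ₐ[F] Module.End F V × Module.End F V :=
    AlgEquiv.ofBijective (hq.cliffordLift m.evenHom) (hq.bijective_cliffordLift e he m.evenHom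
      (m.twist he) (m.twist_evenHom he) hE)
  have hΦ : ∀ z, Φ z = hq.cliffordLift m.evenHom z := fun _ => rfl
  -- The pair is transported back along `Φ`, so the isomorphism is automatic; what needs proof is
  -- that the transported pair is canonical.
  refine ⟨(hq.Ad.prod hq.Ad).map Φ.symm hn, ⟨?_, ?_, ?_⟩, ⟨QuadraticPair.mapIso _ _ _⟩⟩
  · obtain ⟨e', h, -, -⟩ := hq.exists_dual e
    -- Its trace is `b_q(e' 0, e 0) = 1`.
    refine ⟨standardEnd q (e 0) (e' 0), Subtype.ext ?_⟩
    rw [coe_reducedTrace_end, trace_standardEnd, h]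
    simp
  · ext z
    apply Φ.injective
    rw [hΦ (hq.Ad.canonicalInvolution z), m.cliffordLift_canonicalInvolution]
    exact Φ.apply_symm_apply _
  · intro l hl s
    have hl1 : LinearMap.trace F V l = 1 := by
      have := congrArg Subtype.val hl
      rw [coe_reducedTrace_end] at this
      exact IsNonsingularForm.algebraMap_end_injective (by rw [this, map_one]; rfl)
    have hs : (hq.Ad.prod hq.Ad).σ (Φ s) = Φ s := by
      have : Φ.symm ((hq.Ad.prod hq.Ad).σ (Φ s)) = s := s.2
      rw [← Φ.apply_symm_apply ((hq.Ad.prod hq.Ad).σ (Φ s)), this]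
    have h1 := (m.trace_evenMap_mul hq l (congrArg Prod.fst hs)).1
    have h2 := (m.trace_evenMap_mul hq l (congrArg Prod.snd hs)).2
    rw [hl1, one_mul] at h1 h2
    rw [LinearMap.fst_apply] at h1
    rw [LinearMap.snd_apply] at h2
    apply Subtype.ext
    rw [← Φ.symm_apply_apply (hq.Ad.c l * s), (hq.Ad.prod hq.Ad).hasReducedTrace.reducedTrace_map,
      hq.Ad.hasReducedTrace.reducedTrace_prod hq.Ad.hasReducedTrace, coe_reducedTrace_end,
      coe_reducedTrace_end, map_mul, hΦ (hq.Ad.c l), hq.cliffordLift_c, Prod.fst_mul,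
      Prod.snd_mul, h1, h2]
    rfl

end SymmetricComposition

/-! ### The para-octonion product -/

section Octonion

open scoped Quaternion

variable {F : Type*} [Field F] (a b c μ : F)

/-- The para-octonion product on the Cayley–Dickson double of a quaternion algebra. -/
def paraOctonionMul : (ℍ[F,a,b,c] × ℍ[F,a,b,c]) →ₗ[F] (ℍ[F,a,b,c] × ℍ[F,a,b,c]) →ₗ[F]
    (ℍ[F,a,b,c] × ℍ[F,a,b,c]) :=
  LinearMap.mk₂ F
    -- This is `x̄ ȳ` for the doubling `(p, q)(r, s) = (p r + μ s̄ q, s p + q r̄)` with conjugate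
    -- `(p̄, -q)`.
    (fun x y => (star x.1 * star y.1 + μ • (star y.2 * x.2), -(y.2 * star x.1) - x.2 * y.1))
    (fun x x' y => by
      ext1 <;> simp only [Prod.fst_add, Prod.snd_add, star_add, add_mul, mul_add, smul_add] <;> abel)
    (fun r x y => by
      ext1 <;> simp [smul_add, smul_sub, smul_comm μ r])
    (fun x y y' => by
      ext1 <;> simp only [Prod.fst_add, Prod.snd_add, star_add, add_mul, mul_add, smul_add] <;> abel)
    (fun r x y => by
      ext1 <;> simp [smul_add, smul_sub, smul_comm μ r])

theorem paraOctonionMul_apply (x y : ℍ[F,a,b,c] × ℍ[F,a,b,c]) : paraOctonionMul a b c μ x y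
    = (star x.1 * star y.1 + μ • (star y.2 * x.2), -(y.2 * star x.1) - x.2 * y.1) := rfl

/-- The norm of an octonion. -/
def octonionNorm (x : ℍ[F,a,b,c] × ℍ[F,a,b,c]) : F :=
  (x.1 * star x.1).re - μ * (x.2 * star x.2).re

variable {a b c μ}

theorem QuaternionAlgebra.mul_mul_star (p r : ℍ[F,a,b,c]) :
    r * (p * star p) = (p * star p).re • r := by
  rw [QuaternionAlgebra.mul_star_eq_coe, QuaternionAlgebra.re_coe,
    QuaternionAlgebra.mul_coe_eq_smul]

theorem QuaternionAlgebra.mul_star_mul (p r : ℍ[F,a,b,c]) :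
    p * star p * r = (p * star p).re • r := by
  rw [QuaternionAlgebra.mul_star_eq_coe, QuaternionAlgebra.re_coe,
    QuaternionAlgebra.coe_mul_eq_smul]

/-- Quaternions are associative, so the mixed terms cancel in each component; what remains are the
central factors `p p̄` and `q q̄`, which make up the norm. -/
theorem paraOctonionMul_mul_self (x y : ℍ[F,a,b,c] × ℍ[F,a,b,c]) :
    paraOctonionMul a b c μ (paraOctonionMul a b c μ x y) x = octonionNorm a b c μ x • y := by
  obtain ⟨p, q⟩ := x
  obtain ⟨r, s⟩ := y
  simp only [paraOctonionMul_apply, octonionNorm, star_add, star_mul, star_star,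
    QuaternionAlgebra.star_smul]
  refine Prod.ext ?_ ?_
  · calc (r * p + μ • (star q * s)) * star p + μ • (star q * (-(s * star p) - q * r))
        = r * (p * star p) - μ • (star q * q * r) := by
          simp only [add_mul, mul_sub, mul_neg, smul_mul_assoc, smul_sub, smul_neg, mul_assoc]
          abel
      _ = _ := by
          rw [star_comm_self' q, QuaternionAlgebra.mul_mul_star, QuaternionAlgebra.mul_star_mul,
            smul_smul, ← sub_smul]
          rfl
  · calc -(q * (r * p + μ • (star q * s))) - (-(s * star p) - q * r) * p
        = s * (star p * p) - μ • (q * star q * s) := by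
          simp only [mul_add, sub_mul, neg_mul, mul_smul_comm, mul_assoc]
          abel
      _ = _ := by
          rw [star_comm_self' p, QuaternionAlgebra.mul_mul_star, QuaternionAlgebra.mul_star_mul,
            smul_smul, ← sub_smul]
          rfl

theorem self_paraOctonionMul_mul (x y : ℍ[F,a,b,c] × ℍ[F,a,b,c]) :
    paraOctonionMul a b c μ x (paraOctonionMul a b c μ y x) = octonionNorm a b c μ x • y := by
  obtain ⟨p, q⟩ := x
  obtain ⟨r, s⟩ := y
  simp only [paraOctonionMul_apply, octonionNorm, star_add, star_sub, star_neg, star_mul, star_star,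
    QuaternionAlgebra.star_smul]
  refine Prod.ext ?_ ?_
  · calc star p * (p * r + μ • (star s * q)) + μ • ((-(r * star q) - star p * star s) * q)
        = star p * p * r - μ • (r * (star q * q)) := by
          simp only [mul_add, sub_mul, neg_mul, mul_smul_comm, smul_sub, smul_neg, mul_assoc]
          abel
      _ = _ := by
          rw [star_comm_self' q, star_comm_self' p, QuaternionAlgebra.mul_mul_star,
            QuaternionAlgebra.mul_star_mul, smul_smul, ← sub_smul]
          rfl
  · calc -((-(q * star r) - s * p) * star p) - q * (star r * star p + μ • (star q * s))
        = s * (p * star p) - μ • (q * star q * s) := by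
          simp only [mul_add, sub_mul, neg_mul, mul_smul_comm, mul_assoc]
          abel
      _ = _ := by
          rw [QuaternionAlgebra.mul_mul_star, QuaternionAlgebra.mul_star_mul,
            smul_smul, ← sub_smul]
          rfl

theorem polar_octonionNorm (x y : ℍ[F,a,b,c] × ℍ[F,a,b,c]) :
    QuadraticMap.polar (octonionNorm a b c μ) x y
      = (x.1 * star y.1 + y.1 * star x.1).re - μ * (x.2 * star y.2 + y.2 * star x.2).re := by
  simp only [QuadraticMap.polar, octonionNorm, Prod.fst_add, Prod.snd_add, star_add, add_mul,
    mul_add, QuaternionAlgebra.re_add]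
  ring

theorem polar_octonionNorm_paraOctonionMul (x y z : ℍ[F,a,b,c] × ℍ[F,a,b,c]) :
    QuadraticMap.polar (octonionNorm a b c μ) (paraOctonionMul a b c μ x y) z
      = QuadraticMap.polar (octonionNorm a b c μ) x (paraOctonionMul a b c μ y z) := by
  simp only [polar_octonionNorm, paraOctonionMul_apply]
  simp
  ring

/-- A quadratic form isometric to the norm form of an octonion algebra admits a symmetric
composition. -/
def SymmetricComposition.ofOctonion {F V : Type*} [Field F] [AddCommGroup V] [Module F V]
    {q : QuadraticForm F V} {a b c μ : F} (ψ : V ≃ₗ[F] ℍ[F,a,b,c] × ℍ[F,a,b,c])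
    (hψ : ∀ x, q x = octonionNorm a b c μ (ψ x)) : SymmetricComposition q where
  mul := ((paraOctonionMul a b c μ).compl₁₂ ψ.toLinearMap ψ.toLinearMap).compr₂
    ψ.symm.toLinearMap
  mul_mul_self x y := by
    simp [paraOctonionMul_mul_self, hψ]
  self_mul_mul x y := by
    simp [self_paraOctonionMul_mul, hψ]
  polarBilin_mul x y z := by
    have hp : ∀ x y, q.polarBilin x y = QuadraticMap.polar (octonionNorm a b c μ) (ψ x) (ψ y) := by
      intro x y
      rw [QuadraticMap.polarBilin_apply_apply, QuadraticMap.polar, QuadraticMap.polar, hψ, hψ, hψ,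
        map_add]
    rw [hp, hp]
    simp [polar_octonionNorm_paraOctonionMul]

end Octonion

/-! ### Threefold Pfister forms as norm forms of octonion algebras -/

section Pfister

open scoped Quaternion

variable {F : Type*} [Field F]

theorem exists_basis_fin_two {v : Fin 2 → F} (hv : v ≠ 0) :
    ∃ β : Module.Basis (Fin 2) F (Fin 2 → F), β 0 = v := by
  obtain ⟨w, hw⟩ := exists_linearIndependent_pair_of_one_lt_finrank (R := F)
    (M := Fin 2 → F) (by simp) hv
  exact ⟨basisOfLinearIndependentOfCardEqFinrank hw (by simp), by simp⟩

/-- One Gram–Schmidt step from a vector of value `1` suffices, and it works in every characteristic.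
-/
theorem IsBinaryRepresentingOne.exists_basis {b : LinearMap.BilinForm F (Fin 2 → F)}
    (hb : IsBinaryRepresentingOne b) : ∃ β : Module.Basis (Fin 2) F (Fin 2 → F),
      b (β 0) (β 0) = 1 ∧ b (β 0) (β 1) = 0 ∧ b (β 1) (β 0) = 0 := by
  obtain ⟨v, hv⟩ := hb.represents_one
  have hv0 : v ≠ 0 := by
    rintro rfl
    simp at hv
  obtain ⟨w, hw⟩ := exists_linearIndependent_pair_of_one_lt_finrank (R := F)
    (M := Fin 2 → F) (by simp) hv0
  have hw' : LinearIndependent F ![v, w - b v w • v] := by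
    rw [LinearIndependent.pair_iff] at hw ⊢
    intro s t h
    obtain ⟨h1, rfl⟩ := hw (s - t * b v w) t (by rw [← h]; module)
    simpa using h1
  have hs : b w v = b v w := hb.isSymm.eq _ _
  refine ⟨basisOfLinearIndependentOfCardEqFinrank hw' (by simp), ?_, ?_, ?_⟩ <;>
    simp [hv, hs]

theorem quadraticForm_basis_fin_two (φ : QuadraticForm F (Fin 2 → F)) (v w : Fin 2 → F)
    (x y : F) : φ (x • v + y • w) = x * x * φ v + x * y * φ.polarBilin v w + y * y * φ w := by
  have h : φ (x • v + y • w) = φ (x • v) + φ (y • w) + φ.polarBilin (x • v) (y • w) := by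
    rw [QuadraticMap.polarBilin_apply_apply, QuadraticMap.polar]
    ring
  rw [h, QuadraticMap.map_smul, QuadraticMap.map_smul, map_smul, map_smul, LinearMap.smul_apply]
  simp only [smul_eq_mul]
  ring

/-- The coordinates of an octonion, indexed by the three steps of the doubling process. -/
def octonionCoord (a b c : F) :
    (ℍ[F,a,b,c] × ℍ[F,a,b,c]) ≃ₗ[F] ((Fin 2 × Fin 2) × Fin 2 → F) where
  toFun x t := ![![![x.1.re, x.1.imI], ![x.1.imJ, x.1.imK]],
    ![![x.2.re, x.2.imI], ![x.2.imJ, x.2.imK]]] t.1.1 t.1.2 t.2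
  invFun f := (⟨f ((0, 0), 0), f ((0, 0), 1), f ((0, 1), 0), f ((0, 1), 1)⟩,
    ⟨f ((1, 0), 0), f ((1, 0), 1), f ((1, 1), 0), f ((1, 1), 1)⟩)
  map_add' x y := by
    ext ⟨⟨i, j⟩, k⟩
    fin_cases i <;> fin_cases j <;> fin_cases k <;> simp
  map_smul' r x := by
    ext ⟨⟨i, j⟩, k⟩
    fin_cases i <;> fin_cases j <;> fin_cases k <;> simp
  left_inv x := rfl
  right_inv f := by
    ext ⟨⟨i, j⟩, k⟩
    fin_cases i <;> fin_cases j <;> fin_cases k <;> rfl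

/-- The form `φ` is the norm of the quadratic algebra `F[i]`, as it represents `1`. Each bilinear
factor diagonalizes as `⟨1, d⟩`, and tensoring with it is a Cayley–Dickson doubling with parameter
`-d`. -/
theorem IsThreefoldPfisterForm.exists_octonion {V : Type*} [AddCommGroup V] [Module F V]
    {π : QuadraticForm F V} (hπ : IsThreefoldPfisterForm π) :
    ∃ (a b c μ : F) (ψ : V ≃ₗ[F] ℍ[F,a,b,c] × ℍ[F,a,b,c]),
      ∀ x, π x = octonionNorm a b c μ (ψ x) := by
  obtain ⟨b₁, b₂, φ, h₁, h₂, -, -, ⟨v, hv⟩, ⟨e⟩⟩ := hπ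
  obtain ⟨β, hβ0, hβ01, hβ10⟩ := h₁.exists_basis
  obtain ⟨γ, hγ0, hγ01, hγ10⟩ := h₂.exists_basis
  obtain ⟨δ, rfl⟩ := exists_basis_fin_two (v := v) (by
    rintro rfl
    simp at hv)
  let T := (β.tensorProduct γ).tensorProduct δ
  -- In `ℍ[F,a,b,c]` one has `i² = a + b i` and `j² = c`, so `x + y i` has norm `x² + b x y - a y²`,
  -- and `j` doubles this norm with factor `-c`. The mixed coefficient `b` is what allows
  -- characteristic 2.
  let C := octonionCoord (-φ (δ 1)) (φ.polarBilin (δ 0) (δ 1)) (-b₂ (γ 1) (γ 1))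
  have key : ∀ x, tensorForm (b₁.tmul b₂) φ (T.equivFun.symm (C x))
      = octonionNorm _ _ _ (-b₁ (β 1) (β 1)) x := by
    intro x
    have hx : T.equivFun.symm (C x)
        = (β 0 ⊗ₜ γ 0) ⊗ₜ (x.1.re • δ 0 + x.1.imI • δ 1)
          + (β 0 ⊗ₜ γ 1) ⊗ₜ (x.1.imJ • δ 0 + x.1.imK • δ 1)
          + (β 1 ⊗ₜ γ 0) ⊗ₜ (x.2.re • δ 0 + x.2.imI • δ 1)
          + (β 1 ⊗ₜ γ 1) ⊗ₜ (x.2.imJ • δ 0 + x.2.imK • δ 1) := by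
      rw [Module.Basis.equivFun_symm_apply]
      simp [T, C, octonionCoord, Fintype.sum_prod_type, Module.Basis.tensorProduct_apply,
        TensorProduct.tmul_add]
      abel
    have hb : ∀ (s t s' t' : Fin 2 → F) (z z' : Fin 2 → F),
        LinearMap.BilinForm.tmul (b₁.tmul b₂) (bilinOf φ) ((s ⊗ₜ t) ⊗ₜ z) ((s' ⊗ₜ t') ⊗ₜ z')
          = b₁ s s' * b₂ t t' * bilinOf φ z z' := by
      intro s t s' t' z z'
      change bilinOf φ z z' * (b₂ t t' * b₁ s s') = _
      ring
    have hz : ∀ z₁ z₂ z₃ z₄ : Fin 2 → F, tensorForm (b₁.tmul b₂) φ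
        ((β 0 ⊗ₜ γ 0) ⊗ₜ z₁ + (β 0 ⊗ₜ γ 1) ⊗ₜ z₂ + (β 1 ⊗ₜ γ 0) ⊗ₜ z₃ + (β 1 ⊗ₜ γ 1) ⊗ₜ z₄)
          = φ z₁ + b₂ (γ 1) (γ 1) * φ z₂
            + b₁ (β 1) (β 1) * (φ z₃ + b₂ (γ 1) (γ 1) * φ z₄) := by
      intro z₁ z₂ z₃ z₄
      rw [tensorForm, LinearMap.BilinMap.toQuadraticMap_apply]
      simp only [map_add, LinearMap.add_apply, hb, hβ0, hβ01, hβ10, hγ0, hγ01, hγ10, zero_mul,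
        mul_zero, one_mul, mul_one, zero_add, add_zero, bilinOf_self]
      ring
    rw [hx, hz]
    simp only [quadraticForm_basis_fin_two, hv]
    simp [octonionNorm]
    ring
  refine ⟨_, _, _, -b₁ (β 1) (β 1), e.toLinearEquiv ≪≫ₗ T.equivFun ≪≫ₗ C.symm, fun x => ?_⟩
  rw [← key, ← e.map_app]
  simp

end Pfister

theorem mainTheorem9 {F V : Type*} [Field F] [AddCommGroup V] [Module F V]
    (π : QuadraticForm F V) (hπ : IsThreefoldPfisterForm π) :
    ∃ R : QuadraticPair F 8 hπ.isNonsingularForm.Ad.Clifford,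
      hπ.isNonsingularForm.Ad.IsCanonical R ∧
      Nonempty (R.Iso (hπ.isNonsingularForm.Ad.prod hπ.isNonsingularForm.Ad)) := by
  obtain ⟨a, b, c, μ, ψ, hψ⟩ := hπ.exists_octonion
  -- The first basis vector must have norm `1`; the ordering of the eight vectors puts the octonion
  -- unit `(1, 0)` there.
  let B := ((QuaternionAlgebra.basisOneIJK a b c).prod
    (QuaternionAlgebra.basisOneIJK a b c)).reindex (finSumFinEquiv (m := 4) (n := 4))
  have hB : B 0 = (1, 0) := by
    have h0 : (finSumFinEquiv (m := 4) (n := 4)).symm 0 = Sum.inl 0 := rfl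
    rw [Module.Basis.reindex_apply, h0]
    ext <;> simp [QuaternionAlgebra.basisOneIJK]
  refine (SymmetricComposition.ofOctonion ψ hψ).exists_isCanonical_iso hπ.isNonsingularForm
    (B.map ψ.symm) ?_
  rw [Module.Basis.map_apply, hB, hψ, LinearEquiv.apply_symm_apply]
  simp [octonionNorm]

end
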